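/- Call a function $f:\mathbb{R}^d\to[0,\infty)$ log-concave if $f=e^{-V}$ for a convex function $V:\mathbb{R}^d\to\mathbb{R}\cup\{+\infty\}$, and let $$[\mathrm{Cov}_{\mathbb{R}^d}(f)]_{ij}=\frac{\int x_ix_jf(x)\,dx}{\int f}-\frac{\int x_if(x)\,dx\int x_jf(x)\,dx}{\left(\int f\right)^2},\qquad \sigma(f)=\det\left(\mathrm{Cov}_{\mathbb{R}^d}(f)\right)^{\frac1{2d}}.$$ For $A\in\mathbb{R}$ say that $f$ is almost isotropic with implied constant $A$ if $|\mathrm{Cov}_{\mathbb{R}^d}(f)_{ii}-\sigma(f)^2|\le A\,\sigma(f)$ for all $i$ and $|\mathrm{Cov}_{\mathbb{R}^d}(f)_{ij}|\le A\,\sigma(f)$ for all $i\ne j$. For a p.m.f. $p$ on $\mathbb{Z}^d$ let $\mathrm{Cov}_{\mathbb{Z}^d}(p)_{ij}=\sum_k k_ik_jp(k)-\sum_k k_ip(k)\sum_k k_jp(k)$. Theorem. Let $d\ge1$. There is a constant $C'_d>0$, depending only on $d$, such that for every $A$ there is a number $N=N(d,A)$ with the following property. Let $p$ be a p.m.f.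 on $\mathbb{Z}^d$ which is log-concave with almost isotropic extension, that is, there is a log-concave function $f$ on $\mathbb{R}^d$ (not necessarily a probability density) with $f(k)=p(k)$ for all $k\in\mathbb{Z}^d$ which is almost isotropic with implied constant $A$. If $\det(\mathrm{Cov}_{\mathbb{R}^d}(f))\ge N$, then $$\max_{k\in\mathbb{Z}^d}p(k)\le\frac{C'_d}{\det\left(\mathrm{Cov}_{\mathbb{Z}^d}(p)\right)^{1/2}}.$$ -/

import Mathlib

open MeasureTheory

/-- A function `V : ℝ^d → ℝ ∪ {+∞}` (an `EReal`-valued function that omits `-∞`) is convex. -/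
def ConvexExtended {d : ℕ} (V : (Fin d → ℝ) → EReal) : Prop :=
  (∀ x, V x ≠ ⊥) ∧
    ∀ (x y : Fin d → ℝ) (a b : ℝ), 0 < a → 0 < b → a + b = 1 →
      V (a • x + b • y) ≤ (a : EReal) * V x + (b : EReal) * V y

/-- `f : ℝ^d → [0, ∞)` is log-concave: `f = e^{-V}` with `V : ℝ^d → ℝ ∪ {+∞}` convex
(and `e^{-∞} = 0`). -/
def IsLogConcave {d : ℕ} (f : (Fin d → ℝ) → ℝ) : Prop :=
  ∃ V : (Fin d → ℝ) → EReal, ConvexExtended V ∧ ∀ x, f x = (EReal.exp (-V x)).toReal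

/-- `f` is a log-concave extension to `ℝ^d` of the probability mass function `p` on `ℤ^d`.
A p.m.f. is (extensible) log-concave when it has such an extension. -/
def IsLogConcaveExtension {d : ℕ} (p : PMF (Fin d → ℤ)) (f : (Fin d → ℝ) → ℝ) : Prop :=
  IsLogConcave f ∧ ∀ k : Fin d → ℤ, f (fun i => (k i : ℝ)) = (p k).toReal

/-- The covariance matrix of a non-negative, not necessarily normalised, function on `ℝ^d`.
If `f` is log-concave with `0 < ∫ f < ∞`, then all the integrals converge; if `f` is not integrable
or `∫ f = 0`, this is the zero matrix. -/
noncomputable def covR {d : ℕ} (f : (Fin d → ℝ) → ℝ) : Matrix (Fin d) (Fin d) ℝ :=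
  Matrix.of fun i j =>
    (∫ x, x i * x j * f x) / (∫ x, f x)
      - ((∫ x, x i * f x) * (∫ x, x j * f x)) / (∫ x, f x) ^ 2

/-- The covariance matrix of a probability mass function on `ℤ^d`. -/
noncomputable def covZ {d : ℕ} (p : PMF (Fin d → ℤ)) : Matrix (Fin d) (Fin d) ℝ :=
  Matrix.of fun i j =>
    (∑' k : Fin d → ℤ, (k i : ℝ) * (k j : ℝ) * (p k).toReal)
      - (∑' k : Fin d → ℤ, (k i : ℝ) * (p k).toReal)
        * (∑' k : Fin d → ℤ, (k j : ℝ) * (p k).toReal)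

/-- The parameter `σ = det(Cov f)^{1/(2d)}`. -/
noncomputable def sigmaR {d : ℕ} (f : (Fin d → ℝ) → ℝ) : ℝ :=
  (covR f).det ^ (1 / (2 * (d : ℝ)))

/-- `f` is almost isotropic with implied constant `A`: the diagonal entries of `Cov f` are
`σ² + O(σ)` and the off-diagonal ones are `O(σ)`, all error terms being at most `A σ`.
A family of functions is almost isotropic as `σ → ∞` when, for some `A`, this holds for all its
members whose `σ` is large enough. -/
def AlmostIsotropic {d : ℕ} (A : ℝ) (f : (Fin d → ℝ) → ℝ) : Prop :=
  (∀ i, |covR f i i - sigmaR f ^ 2| ≤ A * sigmaR f) ∧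
    ∀ i j, i ≠ j → |covR f i j| ≤ A * sigmaR f

/-!
Centre `f` at its barycentre and rescale it by `σ`: this gives a log-concave probability density `g`
whose covariance lies between two fixed multiples of the identity. Such densities obey uniform
bounds. On the one hand `g(x) ≤ S e^{-κ|x|}`, where `S` is comparable to `max g`: integrating
`√(g x) √(g y) ≤ g((x + y) / 2)` shows that `g` has dropped by a fixed factor at a distance given by
the second moment, and log-concavity propagates the drop exponentially. On the other hand `g ≥ t S`
on a fixed ball: otherwise a hyperplane close to the origin separates the ball from the convex set
`{g ≥ t S}`, so that beyond it `g` is negligible; since the barycentre is the origin, the first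
absolute moment in that direction is then small, hence so is the variance, by Hölder's inequality
between the moments of orders `1`, `2` and `3`.

Back on the lattice, `p ≥ t S` on a ball of radius comparable to `σ` and `∑ p = 1` give
`max p ≤ S = O(σ^{-d})`, while the exponential bound gives `det Cov(p) = O(σ^{2d})`.
-/

/-- Multiplicative form of log-concavity for a non-negative real-valued function: unlike the
definition through a convex function with values in `(-∞, ∞]`, it involves real numbers only. -/
structure MulLogConcave {E : Type*} [AddCommGroup E] [Module ℝ E] (g : E → ℝ) : Prop where
  nonneg : ∀ x, 0 ≤ g x
  rpow_mul_rpow_le : ∀ (x y : E) (a b : ℝ), 0 < a → 0 < b → a + b = 1 →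
    g x ^ a * g y ^ b ≤ g (a • x + b • y)

lemma midpoint_eq_add_smul {E : Type*} [AddCommGroup E] [Module ℝ E] (x y : E) :
    midpoint ℝ x y = (2⁻¹ : ℝ) • x + (2⁻¹ : ℝ) • y := by
  rw [midpoint_eq_smul_add, smul_add, invOf_eq_inv]

lemma norm_le_two_mul_norm_midpoint_add {E : Type*} [NormedAddCommGroup E] [NormedSpace ℝ E]
    (x y : E) : ‖y‖ ≤ 2 * ‖midpoint ℝ x y‖ + ‖x‖ := by
  have h : y = (2 : ℝ) • midpoint ℝ x y - x := by rw [midpoint_eq_add_smul]; module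
  calc ‖y‖ = ‖(2 : ℝ) • midpoint ℝ x y - x‖ := by rw [← h]
    _ ≤ ‖(2 : ℝ) • midpoint ℝ x y‖ + ‖x‖ := norm_sub_le _ _
    _ = 2 * ‖midpoint ℝ x y‖ + ‖x‖ := by rw [norm_smul, Real.norm_of_nonneg two_pos.le]

namespace MulLogConcave

section Module

variable {E F : Type*} [AddCommGroup E] [Module ℝ E] [AddCommGroup F] [Module ℝ F] {g : E → ℝ}

lemma const_mul (hg : MulLogConcave g) {c : ℝ} (hc : 0 < c) :
    MulLogConcave fun x => c * g x where
  nonneg x := mul_nonneg hc.le (hg.nonneg x)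
  rpow_mul_rpow_le x y a b ha hb hab := by
    calc (c * g x) ^ a * (c * g y) ^ b
        = c ^ (a + b) * (g x ^ a * g y ^ b) := by
          rw [Real.mul_rpow hc.le (hg.nonneg x), Real.mul_rpow hc.le (hg.nonneg y),
            Real.rpow_add hc]
          ring
      _ ≤ c * g (a • x + b • y) := by
          rw [hab, Real.rpow_one]
          exact mul_le_mul_of_nonneg_left (hg.rpow_mul_rpow_le x y a b ha hb hab) hc.le

lemma comp_affineMap (hg : MulLogConcave g) (T : F →ᵃ[ℝ] E) :
    MulLogConcave fun x => g (T x) where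
  nonneg x := hg.nonneg (T x)
  rpow_mul_rpow_le x y a b ha hb hab := by
    rw [Convex.combo_affine_apply hab]
    exact hg.rpow_mul_rpow_le _ _ a b ha hb hab

lemma convex_superlevel (hg : MulLogConcave g) {s : ℝ} (hs : 0 < s) :
    Convex ℝ {x | s ≤ g x} := by
  rw [convex_iff_forall_pos]
  intro x hx y hy a b ha hb hab
  simp only [Set.mem_ofPred_eq] at *
  calc s = s ^ a * s ^ b := by rw [← Real.rpow_add hs, hab, Real.rpow_one]
    _ ≤ g x ^ a * g y ^ b := by have := hg.nonneg x; gcongr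
    _ ≤ g (a • x + b • y) := hg.rpow_mul_rpow_le x y a b ha hb hab

lemma sqrt_mul_sqrt_le_midpoint (hg : MulLogConcave g) (x y : E) :
    √(g x) * √(g y) ≤ g (midpoint ℝ x y) := by
  rw [Real.sqrt_eq_rpow, Real.sqrt_eq_rpow, midpoint_eq_add_smul, one_div]
  exact hg.rpow_mul_rpow_le x y _ _ (by norm_num) (by norm_num) (by norm_num)

lemma le_mul_midpoint (hg : MulLogConcave g) {u x : E} {s : ℝ} (hs : 0 ≤ s)
    (hx : g x ≤ s ^ 2 * g u) : g x ≤ s * g (midpoint ℝ u x) := by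
  have hsqrt : √(g x) ≤ s * √(g u) := by
    rw [← Real.sqrt_sq hs, ← Real.sqrt_mul (sq_nonneg s)]
    exact Real.sqrt_le_sqrt hx
  calc g x = √(g x) * √(g x) := (Real.mul_self_sqrt (hg.nonneg x)).symm
    _ ≤ s * √(g u) * √(g x) := by gcongr
    _ = s * (√(g u) * √(g x)) := mul_assoc ..
    _ ≤ s * g (midpoint ℝ u x) := by gcongr; exact hg.sqrt_mul_sqrt_le_midpoint u x

end Module

section Normed

variable {E : Type*} [NormedAddCommGroup E] [NormedSpace ℝ E] {g : E → ℝ} {u : E} {r : ℝ}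

-- Log-concavity along the ray from `u` through `x`, which leaves the ball of radius `r` at `y`.
lemma le_mul_exp_of_lt_norm_sub (hg : MulLogConcave g) (hu : 0 < g u) (hr : 0 < r)
    (hfar : ∀ y, r ≤ ‖y - u‖ → g y ≤ g u / 2) {x : E} (hx : r < ‖x - u‖) :
    g x ≤ g u * Real.exp (-(Real.log 2 / r * ‖x - u‖)) := by
  rcases (hg.nonneg x).eq_or_lt with hgx | hgx
  · rw [← hgx]; positivity
  have hdist : 0 < ‖x - u‖ := hr.trans hx
  set s := r / ‖x - u‖
  have hs : 0 < s := by positivity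
  have hs1 : s < 1 := (div_lt_one hdist).2 hx
  have hy : g ((1 - s) • u + s • x) ≤ g u / 2 := by
    refine hfar _ (le_of_eq ?_)
    rw [show (1 - s) • u + s • x - u = s • (x - u) by module, norm_smul,
      Real.norm_of_nonneg hs.le, div_mul_cancel₀ r hdist.ne']
  have hlog := Real.log_le_log (by positivity)
    ((hg.rpow_mul_rpow_le u x (1 - s) s (by linarith) hs (by ring)).trans hy)
  rw [Real.log_mul (by positivity) (by positivity), Real.log_rpow hu, Real.log_rpow hgx,
    Real.log_div hu.ne' two_ne_zero] at hlog
  rw [← Real.log_le_log_iff hgx (by positivity), Real.log_mul hu.ne' (Real.exp_ne_zero _),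
    Real.log_exp]
  have hslope : Real.log 2 / r * ‖x - u‖ = Real.log 2 / s := by simp only [s]; field_simp
  have : Real.log 2 / s ≤ Real.log (g u) - Real.log (g x) := by
    rw [div_le_iff₀ hs]; linarith
  linarith

lemma le_mul_exp (hg : MulLogConcave g) (hu : 0 < g u) (hr : 0 < r) (hmax : ∀ x, g x ≤ 2 * g u)
    (hfar : ∀ y, r ≤ ‖y - u‖ → g y ≤ g u / 2) (x : E) :
    g x ≤ 4 * g u * Real.exp (-(Real.log 2 / r * ‖x - u‖)) := by
  rcases lt_or_ge r ‖x - u‖ with hx | hx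
  · refine (hg.le_mul_exp_of_lt_norm_sub hu hr hfar hx).trans ?_
    gcongr
    linarith
  · calc g x ≤ 4 * g u * (1 / 2) := by linarith [hmax x]
      _ = 4 * g u * Real.exp (-(Real.log 2 / r * r)) := by
          rw [div_mul_cancel₀ _ hr.ne', Real.exp_neg, Real.exp_log two_pos, one_div]
      _ ≤ 4 * g u * Real.exp (-(Real.log 2 / r * ‖x - u‖)) := by
          have := Real.log_pos one_lt_two
          gcongr

-- Either `x` or the midpoint of `x` and the far point `y` is far from the origin.
lemma mul_sqrt_le_of_norm_ge (hg : MulLogConcave g) {R S : ℝ} (hR : 0 < R)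
    (hS : ∀ x, g x ≤ S) {y : E} (hy : 3 * R ≤ ‖y‖) (x : E) :
    g x * √(g y) ≤ √S / R ^ 2 *
      (‖x‖ ^ 2 * g x + ‖midpoint ℝ y x‖ ^ 2 * g (midpoint ℝ y x)) := by
  have hgx := hg.nonneg x
  have hgz := hg.nonneg (midpoint ℝ y x)
  rw [div_mul_eq_mul_div, le_div_iff₀ (by positivity)]
  rcases le_or_gt R ‖x‖ with hx | hx
  · calc g x * √(g y) * R ^ 2 ≤ g x * √S * ‖x‖ ^ 2 := by gcongr; exact hS y
      _ = √S * (‖x‖ ^ 2 * g x + 0) := by ring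
      _ ≤ _ := by gcongr; positivity
  · have hz : R ≤ ‖midpoint ℝ y x‖ := by
      have := norm_le_two_mul_norm_midpoint_add x y
      rw [midpoint_comm] at this
      linarith
    calc g x * √(g y) * R ^ 2 = √(g x) * (√(g y) * √(g x)) * R ^ 2 := by
          nth_rewrite 1 [← Real.mul_self_sqrt hgx]; ring
      _ ≤ √S * g (midpoint ℝ y x) * ‖midpoint ℝ y x‖ ^ 2 := by
          gcongr
          · exact hS x
          · exact hg.sqrt_mul_sqrt_le_midpoint y x
      _ = √S * (0 + ‖midpoint ℝ y x‖ ^ 2 * g (midpoint ℝ y x)) := by ring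
      _ ≤ _ := by gcongr; positivity

lemma norm_pow_mul_le (hg : MulLogConcave g) {κ : ℝ} (hκ : 0 < κ)
    (hdecay : ∀ x, g x ≤ 9 * g u * Real.exp (-(κ * ‖x‖))) (k : ℕ) (x : E) :
    ‖x‖ ^ k * g x ≤ 3 * k.factorial * (2 / κ) ^ k * g (midpoint ℝ u x) := by
  have hmid : g x ≤ 3 * Real.exp (-(κ / 2 * ‖x‖)) * g (midpoint ℝ u x) := by
    refine hg.le_mul_midpoint (by positivity) ((hdecay x).trans_eq ?_)
    rw [mul_pow, ← Real.exp_nat_mul]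
    ring_nf
  have hpow : ‖x‖ ^ k * Real.exp (-(κ / 2 * ‖x‖)) ≤ k.factorial * (2 / κ) ^ k := by
    have := Real.pow_div_factorial_le_exp (x := κ / 2 * ‖x‖) (by positivity) k
    rw [div_le_iff₀ (by positivity), mul_pow] at this
    rw [Real.exp_neg, ← div_eq_mul_inv, div_le_iff₀ (Real.exp_pos _)]
    calc ‖x‖ ^ k = (2 / κ) ^ k * ((κ / 2) ^ k * ‖x‖ ^ k) := by
          rw [← mul_assoc, ← mul_pow, div_mul_div_cancel₀ hκ.ne', div_self two_ne_zero, one_pow,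
            one_mul]
      _ ≤ (2 / κ) ^ k * (Real.exp (κ / 2 * ‖x‖) * k.factorial) := by gcongr
      _ = _ := by ring
  calc ‖x‖ ^ k * g x ≤ ‖x‖ ^ k * (3 * Real.exp (-(κ / 2 * ‖x‖)) * g (midpoint ℝ u x)) := by gcongr
    _ = 3 * (‖x‖ ^ k * Real.exp (-(κ / 2 * ‖x‖))) * g (midpoint ℝ u x) := by ring
    _ ≤ 3 * (k.factorial * (2 / κ) ^ k) * g (midpoint ℝ u x) := by gcongr; exact hg.nonneg _
    _ = _ := by ring

lemma abs_dual_mul_le (hg : MulLogConcave g) {φ : StrongDual ℝ E} (hφ : ‖φ‖ = 1)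
    {c s : ℝ} (hc : 0 ≤ c) (hs : 0 ≤ s) (hsmall : ∀ x, c < φ x → g x ≤ s ^ 2 * g u) (x : E) :
    |φ x| * g x ≤ 2 * c * g x
      + 2 * s * ((1 + ‖u‖ + ‖midpoint ℝ u x‖ ^ 2) * g (midpoint ℝ u x)) - φ x * g x := by
  have hgx := hg.nonneg x
  have hgz := hg.nonneg (midpoint ℝ u x)
  rcases le_or_gt (φ x) c with hx | hx
  · have hφx : |φ x| + φ x ≤ 2 * c := by
      rcases abs_cases (φ x) with ⟨h, _⟩ | ⟨h, _⟩ <;> linarith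
    have : 0 ≤ 2 * s * ((1 + ‖u‖ + ‖midpoint ℝ u x‖ ^ 2) * g (midpoint ℝ u x)) := by positivity
    nlinarith [mul_le_mul_of_nonneg_right hφx hgx]
  · have hnorm : φ x ≤ 1 + ‖u‖ + ‖midpoint ℝ u x‖ ^ 2 := by
      have hφx : φ x ≤ ‖x‖ := by simpa [hφ] using (le_abs_self _).trans (φ.le_opNorm x)
      have := norm_le_two_mul_norm_midpoint_add u x
      nlinarith [sq_nonneg (‖midpoint ℝ u x‖ - 1)]
    have hmul : φ x * g x ≤
        (1 + ‖u‖ + ‖midpoint ℝ u x‖ ^ 2) * (s * g (midpoint ℝ u x)) := by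
      gcongr
      exact hg.le_mul_midpoint hs (hsmall x hx)
    rw [abs_of_pos (hc.trans_lt hx)]
    nlinarith [mul_nonneg hc hgx]

end Normed

end MulLogConcave

lemma IsLogConcave.mulLogConcave {d : ℕ} {f : (Fin d → ℝ) → ℝ} (hf : IsLogConcave f) :
    MulLogConcave f := by
  obtain ⟨V, ⟨hbot, hconv⟩, hfV⟩ := hf
  have hnonneg : ∀ x, 0 ≤ f x := fun x => by rw [hfV]; exact ENNReal.toReal_nonneg
  have hf_top : ∀ z, V z = ⊤ → f z = 0 := fun z hz => by rw [hfV, hz]; simp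
  have hf_exp : ∀ z, V z ≠ ⊤ → f z = Real.exp (-(V z).toReal) := fun z hz => by
    rw [hfV, ← EReal.coe_toReal hz (hbot z), ← EReal.coe_neg, EReal.exp_coe,
      ENNReal.toReal_ofReal (Real.exp_pos _).le, EReal.toReal_coe]
  refine ⟨hnonneg, fun x y a b ha hb hab => ?_⟩
  by_cases hx : V x = ⊤
  · rw [hf_top x hx, Real.zero_rpow ha.ne', zero_mul]; exact hnonneg _
  by_cases hy : V y = ⊤
  · rw [hf_top y hy, Real.zero_rpow hb.ne', mul_zero]; exact hnonneg _
  have hV := hconv x y a b ha hb hab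
  rw [← EReal.coe_toReal hx (hbot x), ← EReal.coe_toReal hy (hbot y), ← EReal.coe_mul,
    ← EReal.coe_mul, ← EReal.coe_add] at hV
  have hz : V (a • x + b • y) ≠ ⊤ := ne_top_of_le_ne_top (EReal.coe_ne_top _) hV
  rw [← EReal.coe_toReal hz (hbot _), EReal.coe_le_coe_iff] at hV
  rw [hf_exp _ hx, hf_exp _ hy, hf_exp _ hz, ← Real.exp_mul, ← Real.exp_mul, ← Real.exp_add]
  exact Real.exp_le_exp.2 (by linarith)

section ChangeOfVariables

variable {E : Type*} [NormedAddCommGroup E] [NormedSpace ℝ E] [FiniteDimensional ℝ E]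
  [MeasurableSpace E] [BorelSpace E] (μ : Measure E) [μ.IsAddHaarMeasure]

lemma integral_comp_add_smul (h : E → ℝ) (u : E) {r : ℝ} (hr : 0 ≤ r) :
    ∫ x, h (u + r • x) ∂μ = (r ^ Module.finrank ℝ E)⁻¹ * ∫ x, h x ∂μ := by
  rw [Measure.integral_comp_smul μ (fun x => h (u + x)) r, integral_add_left_eq_self,
    abs_of_nonneg (by positivity), smul_eq_mul]

variable {μ} in
lemma integrable_comp_add_smul {h : E → ℝ} (hh : Integrable h μ) (u : E) {r : ℝ} (hr : r ≠ 0) :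
    Integrable (fun x => h (u + r • x)) μ :=
  (hh.comp_add_left u).comp_smul hr

lemma integral_comp_midpoint (h : E → ℝ) (u : E) :
    ∫ x, h (midpoint ℝ u x) ∂μ = 2 ^ Module.finrank ℝ E * ∫ x, h x ∂μ := by
  simp only [midpoint_eq_add_smul]
  rw [integral_comp_add_smul μ h _ (by norm_num), inv_pow, inv_inv]

variable {μ} in
lemma integrable_comp_midpoint {h : E → ℝ} (hh : Integrable h μ) (u : E) :
    Integrable (fun x => h (midpoint ℝ u x)) μ := by
  simp only [midpoint_eq_add_smul]
  exact integrable_comp_add_smul hh _ (by norm_num)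

end ChangeOfVariables

section ConvexSets

variable {E : Type*} [NormedAddCommGroup E] [NormedSpace ℝ E] {K : Set E} {c : ℝ}

lemma closedBall_subset_closure_of_forall_dual (hK : Convex ℝ K) (hne : K.Nonempty)
    (h : ∀ φ : StrongDual ℝ E, ‖φ‖ = 1 → ∃ x ∈ K, c ≤ φ x) :
    Metric.closedBall 0 c ⊆ closure K := by
  intro y hy
  by_contra hyK
  obtain ⟨ψ, a, hlt, hay⟩ := geometric_hahn_banach_closed_point hK.closure isClosed_closure hyK
  replace hlt : ∀ x ∈ K, ψ x < a := fun x hx => hlt x (subset_closure hx)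
  have hψ : 0 < ‖ψ‖ := by
    obtain ⟨x, hx⟩ := hne
    rw [norm_pos_iff]
    rintro rfl
    exact lt_asymm (hlt x hx) hay
  obtain ⟨x, hx, hcx⟩ := h (‖ψ‖⁻¹ • ψ) (by simp [norm_smul, hψ.ne'])
  have hψx : ‖ψ‖ * c ≤ ψ x := (le_inv_mul_iff₀ hψ).1 hcx
  have hψy : ψ y ≤ ‖ψ‖ * c := (le_abs_self _).trans
    (ψ.le_opNorm_of_le (mem_closedBall_zero_iff.1 hy))
  linarith [hlt x hx]

lemma interior_closure_eq_interior_of_convex [FiniteDimensional ℝ E] (hK : Convex ℝ K) :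
    interior (closure K) = interior K := by
  rcases (interior (closure K)).eq_empty_or_nonempty with hempty | hne
  · rw [hempty, eq_comm, ← Set.subset_empty_iff, ← hempty]
    exact interior_mono subset_closure
  · refine hK.interior_closure_eq_interior_of_nonempty_interior ?_
    rw [hK.interior_nonempty_iff_affineSpan_eq_top, ← top_le_iff,
      ← hK.closure.interior_nonempty_iff_affineSpan_eq_top.1 hne, affineSpan_le]
    exact closure_minimal (subset_affineSpan ℝ K) (affineSpan ℝ K).closed_of_finiteDimensional

lemma ball_subset_of_forall_dual [FiniteDimensional ℝ E] (hK : Convex ℝ K) (hne : K.Nonempty)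
    (h : ∀ φ : StrongDual ℝ E, ‖φ‖ = 1 → ∃ x ∈ K, c ≤ φ x) : Metric.ball 0 c ⊆ K :=
  calc Metric.ball 0 c ⊆ interior (closure K) := interior_maximal
        (Metric.ball_subset_closedBall.trans
          (closedBall_subset_closure_of_forall_dual hK hne h)) Metric.isOpen_ball
    _ = interior K := interior_closure_eq_interior_of_convex hK
    _ ⊆ K := interior_subset

end ConvexSets

lemma sq_integral_sq_mul_le {Ω : Type*} [MeasurableSpace Ω] {μ : Measure Ω} {X w : Ω → ℝ}
    (hw : ∀ x, 0 ≤ w x) (h1 : Integrable (fun x => |X x| * w x) μ)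
    (h2 : Integrable (fun x => X x ^ 2 * w x) μ) (h3 : Integrable (fun x => |X x| ^ 3 * w x) μ) :
    (∫ x, X x ^ 2 * w x ∂μ) ^ 2 ≤ (∫ x, |X x| * w x ∂μ) * ∫ x, |X x| ^ 3 * w x ∂μ := by
  have hquad : ∀ t : ℝ, 0 ≤ (∫ x, |X x| * w x ∂μ) * (t * t)
      + (-2 * ∫ x, X x ^ 2 * w x ∂μ) * t + ∫ x, |X x| ^ 3 * w x ∂μ := fun t =>
    calc 0 ≤ ∫ x, |X x| * w x * (t - |X x|) ^ 2 ∂μ := integral_nonneg fun x =>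
          mul_nonneg (mul_nonneg (abs_nonneg _) (hw x)) (sq_nonneg _)
      _ = ∫ x, (t * t * (|X x| * w x) - 2 * t * (X x ^ 2 * w x)) + |X x| ^ 3 * w x ∂μ := by
          congr with x
          rw [← sq_abs (X x)]
          ring
      _ = _ := by
          have h12 : Integrable (fun x => t * t * (|X x| * w x) - 2 * t * (X x ^ 2 * w x)) μ :=
            (h1.const_mul _).sub (h2.const_mul _)
          rw [integral_add h12 h3, integral_sub (h1.const_mul _) (h2.const_mul _),
            integral_const_mul, integral_const_mul]
          ring
  have := discrim_le_zero hquad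
  rw [discrim] at this
  linarith

section Densities

variable {E : Type*} [NormedAddCommGroup E] [NormedSpace ℝ E] [MeasurableSpace E]

/-- A log-concave probability density with respect to `μ`. Finiteness of the second moment, which
makes the mean and the covariance meaningful, is part of the definition. -/
structure IsLogConcaveDensity (μ : Measure E) (g : E → ℝ) : Prop extends MulLogConcave g where
  integrable : Integrable g μ
  integral_eq_one : ∫ x, g x ∂μ = 1
  integrable_norm_sq_mul : Integrable (fun x => ‖x‖ ^ 2 * g x) μ

variable {μ : Measure E} {g : E → ℝ} {u : E}

lemma MulLogConcave.exists_pos (hg : MulLogConcave g) (hpos : 0 < ∫ x, g x ∂μ) : ∃ u, 0 < g u := by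
  by_contra! h
  exact hpos.ne' (by simp [show g = 0 from funext fun x => le_antisymm (h x) (hg.nonneg x)])

variable [BorelSpace E]

lemma IsLogConcaveDensity.integrable_mul (hg : IsLogConcaveDensity μ g) {h : E → ℝ}
    (hh : Continuous h) {a b : ℝ} (hab : ∀ x, |h x| ≤ a + b * ‖x‖ ^ 2) :
    Integrable (fun x => h x * g x) μ := by
  refine ((hg.integrable.const_mul a).add (hg.integrable_norm_sq_mul.const_mul b)).mono'
    (hh.aestronglyMeasurable.mul hg.integrable.aestronglyMeasurable) (ae_of_all _ fun x => ?_)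
  rw [norm_mul, Real.norm_eq_abs, Real.norm_of_nonneg (hg.nonneg x)]
  exact (mul_le_mul_of_nonneg_right (hab x) (hg.nonneg x)).trans_eq
    (by simp only [Pi.add_apply]; ring)

lemma IsLogConcaveDensity.integrable_dual_mul (hg : IsLogConcaveDensity μ g) (φ : StrongDual ℝ E) :
    Integrable (fun x => φ x * g x) μ := by
  refine hg.integrable_mul φ.continuous (a := ‖φ‖) (b := ‖φ‖) fun x => ?_
  calc |φ x| ≤ ‖φ‖ * ‖x‖ := φ.le_opNorm x
    _ ≤ ‖φ‖ * (1 + ‖x‖ ^ 2) := by gcongr; nlinarith [sq_nonneg (‖x‖ - 1)]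
    _ = ‖φ‖ + ‖φ‖ * ‖x‖ ^ 2 := by ring

lemma IsLogConcaveDensity.integrable_dual_sq_mul (hg : IsLogConcaveDensity μ g)
    (φ : StrongDual ℝ E) : Integrable (fun x => φ x ^ 2 * g x) μ := by
  refine hg.integrable_mul (φ.continuous.pow 2) (a := 0) (b := ‖φ‖ ^ 2) fun x => ?_
  rw [abs_of_nonneg (sq_nonneg _), zero_add, ← mul_pow, ← sq_abs]
  gcongr
  exact φ.le_opNorm x

variable [FiniteDimensional ℝ E] [μ.IsAddHaarMeasure]

lemma MulLogConcave.integrable_sqrt (hg : MulLogConcave g) (hi : Integrable g μ) (hu : 0 < g u) :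
    Integrable (fun x => √(g x)) μ := by
  refine ((integrable_comp_midpoint hi u).const_mul (√(g u))⁻¹).mono'
    (Real.continuous_sqrt.comp_aestronglyMeasurable hi.aestronglyMeasurable)
    (ae_of_all _ fun x => ?_)
  rw [Real.norm_of_nonneg (Real.sqrt_nonneg _), le_inv_mul_iff₀ (Real.sqrt_pos.2 hu)]
  exact hg.sqrt_mul_sqrt_le_midpoint u x

lemma MulLogConcave.bddAbove_range (hg : MulLogConcave g) (hi : Integrable g μ)
    (hpos : 0 < ∫ x, g x ∂μ) : BddAbove (Set.range g) := by
  obtain ⟨u, hu⟩ := hg.exists_pos hpos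
  have hsqrt := hg.integrable_sqrt hi hu
  have hsqrt_pos : 0 < ∫ x, √(g x) ∂μ := by
    rw [integral_pos_iff_support_of_nonneg hg.nonneg hi] at hpos
    rw [integral_pos_iff_support_of_nonneg (fun x => Real.sqrt_nonneg _) hsqrt]
    refine hpos.trans_le (measure_mono fun x hx => ?_)
    exact (Real.sqrt_pos.2 ((hg.nonneg x).lt_of_ne' hx)).ne'
  refine ⟨((2 ^ Module.finrank ℝ E * ∫ x, g x ∂μ) / ∫ x, √(g x) ∂μ) ^ 2, ?_⟩
  rintro _ ⟨x, rfl⟩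
  refine (Real.sqrt_le_left (by positivity)).1 ?_
  rw [le_div_iff₀ hsqrt_pos, ← integral_const_mul, ← integral_comp_midpoint μ g x]
  exact integral_mono (hsqrt.const_mul _) (integrable_comp_midpoint hi x)
    fun y => hg.sqrt_mul_sqrt_le_midpoint x y

namespace IsLogConcaveDensity

lemma exists_near_max (hg : IsLogConcaveDensity μ g) : ∃ u, 0 < g u ∧ ∀ x, g x ≤ 2 * g u := by
  have hpos : 0 < ∫ x, g x ∂μ := hg.integral_eq_one ▸ one_pos
  have hbdd := hg.bddAbove_range hg.integrable hpos
  obtain ⟨v, hv⟩ := hg.exists_pos hpos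
  have hsup : 0 < ⨆ x, g x := hv.trans_le (le_ciSup hbdd v)
  obtain ⟨u, hu⟩ := exists_lt_of_lt_ciSup (half_lt_self hsup)
  exact ⟨u, (half_pos hsup).trans hu, fun x => (le_ciSup hbdd x).trans (by linarith)⟩

lemma sqrt_le_of_norm_ge (hg : IsLogConcaveDensity μ g) {R S M : ℝ} (hR : 0 < R)
    (hM : ∫ x, ‖x‖ ^ 2 * g x ∂μ ≤ M) (hRM : 4 * 2 ^ Module.finrank ℝ E * M ≤ R ^ 2)
    (hS : ∀ x, g x ≤ S) {y : E} (hy : 3 * R ≤ ‖y‖) : √(g y) ≤ √S / 2 := by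
  have hmid := integrable_comp_midpoint hg.integrable_norm_sq_mul y
  have hM0 : 0 ≤ M :=
    (integral_nonneg fun x => mul_nonneg (sq_nonneg ‖x‖) (hg.nonneg x)).trans hM
  have h2 : (1 : ℝ) ≤ 2 ^ Module.finrank ℝ E := one_le_pow₀ one_le_two
  calc √(g y) = ∫ x, g x * √(g y) ∂μ := by rw [integral_mul_const, hg.integral_eq_one, one_mul]
    _ ≤ ∫ x, √S / R ^ 2 *
          (‖x‖ ^ 2 * g x + ‖midpoint ℝ y x‖ ^ 2 * g (midpoint ℝ y x)) ∂μ :=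
        integral_mono (hg.integrable.mul_const _)
          ((hg.integrable_norm_sq_mul.add hmid).const_mul _) (hg.mul_sqrt_le_of_norm_ge hR hS hy)
    _ = √S / R ^ 2 * ((1 + 2 ^ Module.finrank ℝ E) * ∫ x, ‖x‖ ^ 2 * g x ∂μ) := by
        rw [integral_const_mul, integral_add hg.integrable_norm_sq_mul hmid,
          integral_comp_midpoint μ (fun x => ‖x‖ ^ 2 * g x) y]
        ring
    _ ≤ √S / R ^ 2 * (R ^ 2 / 2) := by
        gcongr
        nlinarith
    _ = √S / 2 := by field_simp

lemma le_half_of_norm_ge (hg : IsLogConcaveDensity μ g) {R M : ℝ} (hR : 0 < R)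
    (hM : ∫ x, ‖x‖ ^ 2 * g x ∂μ ≤ M) (hRM : 4 * 2 ^ Module.finrank ℝ E * M ≤ R ^ 2)
    (hmax : ∀ x, g x ≤ 2 * g u) {y : E} (hy : 3 * R ≤ ‖y‖) : g y ≤ g u / 2 := by
  have hsqrt := hg.sqrt_le_of_norm_ge hR hM hRM hmax hy
  rw [Real.sqrt_le_iff, div_pow, Real.sq_sqrt (by linarith [hg.nonneg u])] at hsqrt
  linarith [hsqrt.2]

-- The factor `9` is a perfect square because the decay is used after taking square roots.
variable (μ) in
lemma exists_exp_decay (M : ℝ) :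
    ∃ ρ κ : ℝ, 0 < ρ ∧ 0 < κ ∧ ∀ g : E → ℝ, IsLogConcaveDensity μ g →
      ∫ x, ‖x‖ ^ 2 * g x ∂μ ≤ M →
        ∃ u, 0 < g u ∧ ‖u‖ ≤ ρ ∧ ∀ x, g x ≤ 9 * g u * Real.exp (-(κ * ‖x‖)) := by
  set R : ℝ := √(4 * 2 ^ Module.finrank ℝ E * (|M| + 1))
  have hR : 0 < R := Real.sqrt_pos.2 (by positivity)
  have hRM : 4 * 2 ^ Module.finrank ℝ E * M ≤ R ^ 2 := by
    rw [Real.sq_sqrt (by positivity)]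
    gcongr
    linarith [le_abs_self M]
  have hκ : 0 < Real.log 2 / (6 * R) := div_pos (Real.log_pos one_lt_two) (by positivity)
  refine ⟨3 * R, Real.log 2 / (6 * R), by positivity, hκ, fun g hg hM => ?_⟩
  obtain ⟨u, hu, hmax⟩ := hg.exists_near_max
  have hfar : ∀ y, 3 * R ≤ ‖y‖ → g y ≤ g u / 2 := fun y => hg.le_half_of_norm_ge hR hM hRM hmax
  have hnorm_u : ‖u‖ ≤ 3 * R := by
    by_contra! h
    linarith [hfar u h.le]
  refine ⟨u, hu, hnorm_u, fun x => ?_⟩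
  have hdecay := hg.le_mul_exp hu (r := 6 * R) (by positivity) hmax
    (fun y hy => hfar y (by linarith [norm_sub_le y u])) x
  have hexp : Real.exp (-(Real.log 2 / (6 * R) * ‖x - u‖)) ≤
      2 * Real.exp (-(Real.log 2 / (6 * R) * ‖x‖)) := by
    rw [← Real.exp_log two_pos, ← Real.exp_add, Real.exp_le_exp, Real.exp_log two_pos]
    have htri : ‖x‖ ≤ ‖x - u‖ + 6 * R := by linarith [norm_le_norm_sub_add x u]
    have := mul_le_mul_of_nonneg_left htri hκ.le
    rw [mul_add, div_mul_cancel₀ _ (by positivity)] at this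
    linarith
  calc g x ≤ 4 * g u * Real.exp (-(Real.log 2 / (6 * R) * ‖x - u‖)) := hdecay
    _ ≤ 4 * g u * (2 * Real.exp (-(Real.log 2 / (6 * R) * ‖x‖))) := by gcongr
    _ = 8 * g u * Real.exp (-(Real.log 2 / (6 * R) * ‖x‖)) := by ring
    _ ≤ 9 * g u * Real.exp (-(Real.log 2 / (6 * R) * ‖x‖)) := by gcongr; norm_num

lemma integrable_norm_pow_mul (hg : IsLogConcaveDensity μ g) {κ : ℝ} (hκ : 0 < κ)
    (hdecay : ∀ x, g x ≤ 9 * g u * Real.exp (-(κ * ‖x‖))) (k : ℕ) :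
    Integrable (fun x => ‖x‖ ^ k * g x) μ :=
  ((integrable_comp_midpoint hg.integrable u).const_mul _).mono'
    ((by fun_prop : Continuous fun x : E => ‖x‖ ^ k).aestronglyMeasurable.mul
      hg.integrable.aestronglyMeasurable)
    (ae_of_all _ fun x => by
      rw [Real.norm_of_nonneg (mul_nonneg (by positivity) (hg.nonneg x))]
      exact hg.norm_pow_mul_le hκ hdecay k x)

lemma integral_norm_pow_mul_le (hg : IsLogConcaveDensity μ g) {κ : ℝ} (hκ : 0 < κ)
    (hdecay : ∀ x, g x ≤ 9 * g u * Real.exp (-(κ * ‖x‖))) (k : ℕ) :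
    ∫ x, ‖x‖ ^ k * g x ∂μ ≤ 3 * k.factorial * (2 / κ) ^ k * 2 ^ Module.finrank ℝ E := by
  refine (integral_mono (hg.integrable_norm_pow_mul hκ hdecay k)
    ((integrable_comp_midpoint hg.integrable u).const_mul _)
    (hg.norm_pow_mul_le hκ hdecay k)).trans_eq ?_
  rw [integral_const_mul, integral_comp_midpoint, hg.integral_eq_one, mul_one]

lemma sq_integral_dual_sq_mul_le (hg : IsLogConcaveDensity μ g) {κ : ℝ} (hκ : 0 < κ)
    (hdecay : ∀ x, g x ≤ 9 * g u * Real.exp (-(κ * ‖x‖))) {φ : StrongDual ℝ E} (hφ : ‖φ‖ = 1) :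
    (∫ x, φ x ^ 2 * g x ∂μ) ^ 2 ≤
      (∫ x, |φ x| * g x ∂μ) * (144 / κ ^ 3 * 2 ^ Module.finrank ℝ E) := by
  have hφ_le : ∀ x, |φ x| ≤ ‖x‖ := fun x => by simpa [hφ] using φ.le_opNorm x
  have hle : ∀ x, |φ x| ^ 3 * g x ≤ ‖x‖ ^ 3 * g x := fun x => by
    have := hg.nonneg x
    gcongr
    exact hφ_le x
  have hint3 := hg.integrable_norm_pow_mul hκ hdecay 3
  have hint : Integrable (fun x => |φ x| ^ 3 * g x) μ :=
    hint3.mono' ((by fun_prop : Continuous fun x => |φ x| ^ 3).aestronglyMeasurable.mul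
      hg.integrable.aestronglyMeasurable) (ae_of_all _ fun x => by
        rw [Real.norm_of_nonneg (mul_nonneg (by positivity) (hg.nonneg x))]; exact hle x)
  have hint1 : Integrable (fun x => |φ x| * g x) μ := by
    simpa only [norm_mul, Real.norm_eq_abs, abs_of_nonneg (hg.nonneg _)] using
      (hg.integrable_dual_mul φ).norm
  calc (∫ x, φ x ^ 2 * g x ∂μ) ^ 2
      ≤ (∫ x, |φ x| * g x ∂μ) * ∫ x, |φ x| ^ 3 * g x ∂μ :=
        sq_integral_sq_mul_le hg.nonneg hint1 (hg.integrable_dual_sq_mul φ) hint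
    _ ≤ (∫ x, |φ x| * g x ∂μ) * (144 / κ ^ 3 * 2 ^ Module.finrank ℝ E) := by
        gcongr
        · exact integral_nonneg fun x => mul_nonneg (abs_nonneg _) (hg.nonneg x)
        · refine (integral_mono hint hint3 hle).trans
            ((hg.integral_norm_pow_mul_le hκ hdecay 3).trans_eq ?_)
          norm_num [Nat.factorial]
          ring

lemma integral_abs_dual_mul_le (hg : IsLogConcaveDensity μ g) {φ : StrongDual ℝ E} (hφ : ‖φ‖ = 1)
    (hmean : ∫ x, φ x * g x ∂μ = 0) {c s : ℝ} (hc : 0 ≤ c) (hs : 0 ≤ s)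
    (hsmall : ∀ x, c < φ x → g x ≤ s ^ 2 * g u) :
    ∫ x, |φ x| * g x ∂μ ≤ 2 * c + 2 * s *
      (2 ^ Module.finrank ℝ E * (1 + ‖u‖ + ∫ x, ‖x‖ ^ 2 * g x ∂μ)) := by
  have habs : Integrable (fun x => |φ x| * g x) μ := by
    simpa only [norm_mul, Real.norm_eq_abs, abs_of_nonneg (hg.nonneg _)] using
      (hg.integrable_dual_mul φ).norm
  have hweight : Integrable (fun x => (1 + ‖u‖ + ‖x‖ ^ 2) * g x) μ := by
    simp only [add_mul _ (_ ^ 2)]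
    exact (hg.integrable.const_mul _).add hg.integrable_norm_sq_mul
  have hmid := (integrable_comp_midpoint hweight u).const_mul (2 * s)
  have hlin := hg.integrable.const_mul (2 * c)
  calc ∫ x, |φ x| * g x ∂μ ≤ ∫ x, 2 * c * g x + 2 * s *
          ((1 + ‖u‖ + ‖midpoint ℝ u x‖ ^ 2) * g (midpoint ℝ u x)) - φ x * g x ∂μ :=
        integral_mono habs ((hlin.add hmid).sub (hg.integrable_dual_mul φ))
          (hg.abs_dual_mul_le hφ hc hs hsmall)
    _ = 2 * c + 2 * s * (2 ^ Module.finrank ℝ E * ∫ x, (1 + ‖u‖ + ‖x‖ ^ 2) * g x ∂μ) := by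
        rw [integral_sub (hlin.fun_add hmid) (hg.integrable_dual_mul φ), hmean, sub_zero,
          integral_add hlin hmid, integral_const_mul, integral_const_mul, hg.integral_eq_one,
          integral_comp_midpoint μ (fun x => (1 + ‖u‖ + ‖x‖ ^ 2) * g x) u, mul_one]
    _ = _ := by
        simp only [add_mul _ (_ ^ 2)]
        rw [integral_add (hg.integrable.const_mul _) hg.integrable_norm_sq_mul, integral_const_mul,
          hg.integral_eq_one, mul_one]

lemma ball_subset_superlevel (hg : IsLogConcaveDensity μ g) {κ : ℝ} (hκ : 0 < κ)
    (hdecay : ∀ x, g x ≤ 9 * g u * Real.exp (-(κ * ‖x‖)))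
    (hmean : ∀ φ : StrongDual ℝ E, ∫ x, φ x * g x ∂μ = 0) {α : ℝ} (hα : 0 ≤ α)
    (hvar : ∀ φ : StrongDual ℝ E, ‖φ‖ = 1 → α ≤ ∫ x, φ x ^ 2 * g x ∂μ)
    (hu : 0 < g u) {c s : ℝ} (hc : 0 ≤ c) (hs : 0 < s) (hs1 : s ≤ 1)
    (hcs : (2 * c + 2 * s * (2 ^ Module.finrank ℝ E * (1 + ‖u‖ + ∫ x, ‖x‖ ^ 2 * g x ∂μ))) *
      (144 / κ ^ 3 * 2 ^ Module.finrank ℝ E) < α ^ 2) :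
    Metric.ball 0 c ⊆ {x | s ^ 2 * g u ≤ g x} := by
  refine ball_subset_of_forall_dual (hg.convex_superlevel (by positivity))
    ⟨u, mul_le_of_le_one_left hu.le (pow_le_one₀ hs.le hs1)⟩ fun φ hφ => ?_
  by_contra! hsmall
  have habs := hg.integral_abs_dual_mul_le (u := u) hφ (hmean φ) hc hs.le
    fun x hx => (not_le.1 fun h => (hsmall x h).not_gt hx).le
  refine hcs.not_ge ?_
  calc α ^ 2 ≤ (∫ x, φ x ^ 2 * g x ∂μ) ^ 2 := by gcongr; exact hvar φ hφ
    _ ≤ _ := hg.sq_integral_dual_sq_mul_le hκ hdecay hφ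
    _ ≤ _ := by gcongr

variable (μ) in
lemma exists_profile (M : ℝ) {α : ℝ} (hα : 0 < α) :
    ∃ c t κ : ℝ, 0 < c ∧ 0 < t ∧ 0 < κ ∧ ∀ g : E → ℝ, IsLogConcaveDensity μ g →
      ∫ x, ‖x‖ ^ 2 * g x ∂μ ≤ M → (∀ φ : StrongDual ℝ E, ∫ x, φ x * g x ∂μ = 0) →
      (∀ φ : StrongDual ℝ E, ‖φ‖ = 1 → α ≤ ∫ x, φ x ^ 2 * g x ∂μ) →
        ∃ S, 0 < S ∧ (∀ x, ‖x‖ < c → t * S ≤ g x) ∧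
          ∀ x, g x ≤ S * Real.exp (-(κ * ‖x‖)) := by
  obtain ⟨ρ, κ, hρ, hκ, hdecay⟩ := exists_exp_decay μ M
  set T : ℝ := 144 / κ ^ 3 * 2 ^ Module.finrank ℝ E
  set B : ℝ := 2 ^ Module.finrank ℝ E * (1 + ρ + |M|)
  have hT : 0 < T := by positivity
  have hB : 0 < B := by positivity
  set c : ℝ := α ^ 2 / (8 * T)
  set s : ℝ := min 1 (c / B)
  have hc : 0 < c := by positivity
  have hs : 0 < s := by positivity
  refine ⟨c, s ^ 2 / 9, κ, hc, by positivity, hκ, fun g hg hM hmean hvar => ?_⟩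
  obtain ⟨u, hu, hnorm_u, hdecay⟩ := hdecay g hg hM
  refine ⟨9 * g u, by positivity, fun x hx => ?_, hdecay⟩
  have hcs : (2 * c + 2 * s *
      (2 ^ Module.finrank ℝ E * (1 + ‖u‖ + ∫ x, ‖x‖ ^ 2 * g x ∂μ))) * T < α ^ 2 := by
    calc _ ≤ (2 * c + 2 * s * B) * T := by
          gcongr
          simp only [B]
          gcongr
          exact hM.trans (le_abs_self M)
      _ ≤ (2 * c + 2 * (c / B) * B) * T := by
          gcongr
          exact min_le_right _ _
      _ = α ^ 2 / 2 := by simp only [c]; field_simp; norm_num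
      _ < α ^ 2 := half_lt_self (by positivity)
  have : s ^ 2 * g u ≤ g x := hg.ball_subset_superlevel hκ hdecay hmean hα.le hvar hu hc.le hs
    (min_le_left _ _) hcs (mem_ball_zero_iff.2 hx)
  linarith

end IsLogConcaveDensity

end Densities

section LatticeSums

lemma inv_one_sub_exp_neg_inv_le {L : ℝ} (hL : 0 < L) : (1 - Real.exp (-L⁻¹))⁻¹ ≤ L + 1 := by
  refine inv_le_of_inv_le₀ (by positivity) ?_
  have hexp : Real.exp (-L⁻¹) ≤ (L⁻¹ + 1)⁻¹ := by
    rw [Real.exp_neg]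
    exact inv_anti₀ (by positivity) (Real.add_one_le_exp _)
  have : (L + 1)⁻¹ = 1 - (L⁻¹ + 1)⁻¹ := by field_simp; ring
  linarith

lemma hasSum_pow_natAbs {r : ℝ} (hr0 : 0 ≤ r) (hr1 : r < 1) :
    HasSum (fun j : ℤ => r ^ j.natAbs) ((1 - r)⁻¹ + r * (1 - r)⁻¹) := by
  have hgeom := hasSum_geometric_of_lt_one hr0 hr1
  refine HasSum.of_nat_of_neg_add_one (by simpa only [Int.natAbs_natCast] using hgeom) ?_
  have hnatAbs : ∀ n : ℕ, (-((n : ℤ) + 1)).natAbs = n + 1 := by lia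
  simpa only [hnatAbs, pow_succ'] using hgeom.mul_left r

lemma exp_neg_abs_sub_le (k : ℤ) (a : ℝ) {L : ℝ} (hL : 1 ≤ L) :
    Real.exp (-(|k - a| / L)) ≤ 3 * Real.exp (-L⁻¹) ^ (k - ⌊a⌋).natAbs := by
  have hfloor : ((k - ⌊a⌋).natAbs : ℝ) ≤ |k - a| + 1 := by
    have htri := abs_sub_le (k : ℝ) a ⌊a⌋
    have hfract : |a - ⌊a⌋| ≤ 1 := by
      rw [Int.self_sub_floor, Int.abs_fract]
      exact (Int.fract_lt_one a).le
    rw [Nat.cast_natAbs, Int.cast_abs, Int.cast_sub]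
    linarith
  have hscale : (k - ⌊a⌋).natAbs / L ≤ |k - a| / L + 1 := by
    have := div_le_one_of_le₀ hL (zero_le_one.trans hL)
    calc (k - ⌊a⌋).natAbs / L ≤ (|k - a| + 1) / L := by gcongr
      _ ≤ |k - a| / L + 1 := by rw [add_div]; gcongr
  calc Real.exp (-(|k - a| / L)) ≤ Real.exp (1 + (k - ⌊a⌋).natAbs * -L⁻¹) := by
        rw [Real.exp_le_exp, mul_neg, ← div_eq_mul_inv]
        linarith
    _ = Real.exp 1 * Real.exp (-L⁻¹) ^ (k - ⌊a⌋).natAbs := by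
        rw [Real.exp_add, Real.exp_nat_mul]
    _ ≤ 3 * Real.exp (-L⁻¹) ^ (k - ⌊a⌋).natAbs := by
        gcongr
        exact Real.exp_one_lt_three.le

lemma sum_exp_neg_abs_sub_le (s : Finset ℤ) (a : ℝ) {L : ℝ} (hL : 1 ≤ L) :
    ∑ k ∈ s, Real.exp (-(|k - a| / L)) ≤ 12 * L := by
  have hL0 : 0 < L := zero_lt_one.trans_le hL
  set r := Real.exp (-L⁻¹)
  have hr1 : r < 1 := Real.exp_lt_one_iff.2 (neg_neg_of_pos (inv_pos.2 hL0))
  have hinv : (1 - r)⁻¹ ≤ 2 * L := (inv_one_sub_exp_neg_inv_le hL0).trans (by linarith)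
  have hsum : HasSum (fun k : ℤ => r ^ (k - ⌊a⌋).natAbs) ((1 - r)⁻¹ + r * (1 - r)⁻¹) :=
    ((Equiv.subRight ⌊a⌋).hasSum_iff (f := fun j : ℤ => r ^ j.natAbs)).2
      (hasSum_pow_natAbs (Real.exp_pos _).le hr1)
  calc ∑ k ∈ s, Real.exp (-(|k - a| / L))
      ≤ ∑ k ∈ s, 3 * r ^ (k - ⌊a⌋).natAbs :=
        Finset.sum_le_sum fun k _ => exp_neg_abs_sub_le k a hL
    _ ≤ 3 * ((1 - r)⁻¹ + r * (1 - r)⁻¹) := by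
        rw [← Finset.mul_sum]
        gcongr
        exact sum_le_hasSum s (fun k _ => by positivity) hsum
    _ ≤ 3 * (2 * L + 1 * (2 * L)) := by
        have : 0 < 1 - r := sub_pos.2 hr1
        gcongr
    _ = 12 * L := by ring

variable {ι : Type*} [Fintype ι]

/-- The inclusion of the integer lattice `ℤ^ι` into `ℝ^ι`, in the form in which
`IsLogConcaveExtension` evaluates an extension at a lattice point. -/
def latticeCast {ι : Type*} (k : ι → ℤ) : ι → ℝ := fun i => (k i : ℝ)

lemma exp_neg_norm_le_prod [Nonempty ι] (x : ι → ℝ) {L : ℝ} (hL : 0 < L) :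
    Real.exp (-(‖x‖ / L)) ≤ ∏ i, Real.exp (-(|x i| / (Fintype.card ι * L))) := by
  rw [← Real.exp_sum, Real.exp_le_exp, Finset.sum_neg_distrib, neg_le_neg_iff, ← Finset.sum_div,
    ← div_div]
  gcongr
  rw [div_le_iff₀' (by positivity), ← nsmul_eq_mul]
  exact Finset.sum_le_card_nsmul _ _ _ fun i _ => norm_le_pi_norm x i

lemma sum_exp_neg_norm_sub_le [Nonempty ι] (s : Finset (ι → ℤ)) (m : ι → ℝ) {L : ℝ} (hL : 1 ≤ L) :
    ∑ k ∈ s, Real.exp (-(‖latticeCast k - m‖ / L)) ≤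
      (12 * (Fintype.card ι * L)) ^ Fintype.card ι := by
  classical
  have hcard : (1 : ℝ) ≤ Fintype.card ι := Nat.one_le_cast.2 Fintype.card_pos
  set t : ι → Finset ℤ := fun i => s.image fun k => k i
  have hst : s ⊆ Fintype.piFinset t := fun k hk =>
    Fintype.mem_piFinset.2 fun i => Finset.mem_image_of_mem _ hk
  calc ∑ k ∈ s, Real.exp (-(‖latticeCast k - m‖ / L))
      ≤ ∑ k ∈ s, ∏ i, Real.exp (-(|k i - m i| / (Fintype.card ι * L))) :=
        Finset.sum_le_sum fun k _ => exp_neg_norm_le_prod (latticeCast k - m) (by linarith)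
    _ ≤ ∑ k ∈ Fintype.piFinset t, ∏ i, Real.exp (-(|k i - m i| / (Fintype.card ι * L))) :=
        Finset.sum_le_sum_of_subset_of_nonneg hst fun k _ _ => by positivity
    _ = ∏ i, ∑ j ∈ t i, Real.exp (-(|j - m i| / (Fintype.card ι * L))) :=
        (Finset.prod_univ_sum t fun i (j : ℤ) =>
          Real.exp (-(|j - m i| / (Fintype.card ι * L)))).symm
    _ ≤ ∏ _i : ι, 12 * (Fintype.card ι * L) :=
        Finset.prod_le_prod (fun i _ => by positivity) fun i _ =>
          sum_exp_neg_abs_sub_le (t i) (m i) (one_le_mul_of_one_le_of_one_le hcard hL)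
    _ = (12 * (Fintype.card ι * L)) ^ Fintype.card ι := by simp

lemma sq_mul_exp_neg_le {t L : ℝ} (ht : 0 ≤ t) (hL : 0 < L) :
    t ^ 2 * Real.exp (-(t / L)) ≤ 8 * L ^ 2 * Real.exp (-(t / (2 * L))) := by
  have hpow : t ^ 2 ≤ 8 * L ^ 2 * Real.exp (t / (2 * L)) := by
    have := Real.pow_div_factorial_le_exp (x := t / (2 * L)) (by positivity) 2
    calc t ^ 2 = 8 * L ^ 2 * ((t / (2 * L)) ^ 2 / (2 : ℕ).factorial) := by
          norm_num [Nat.factorial]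
          field_simp
          norm_num
      _ ≤ 8 * L ^ 2 * Real.exp (t / (2 * L)) := by gcongr
  calc t ^ 2 * Real.exp (-(t / L))
      ≤ 8 * L ^ 2 * Real.exp (t / (2 * L)) * Real.exp (-(t / L)) := by gcongr
    _ = 8 * L ^ 2 * Real.exp (-(t / (2 * L))) := by
        rw [mul_assoc, ← Real.exp_add]
        congr 2
        field_simp
        ring

lemma sum_norm_sub_sq_mul_exp_le [Nonempty ι] (s : Finset (ι → ℤ)) (m : ι → ℝ) {L : ℝ}
    (hL : 1 ≤ L) :
    ∑ k ∈ s, ‖latticeCast k - m‖ ^ 2 * Real.exp (-(‖latticeCast k - m‖ / L)) ≤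
      8 * L ^ 2 * (12 * (Fintype.card ι * (2 * L))) ^ Fintype.card ι := by
  calc ∑ k ∈ s, ‖latticeCast k - m‖ ^ 2 * Real.exp (-(‖latticeCast k - m‖ / L))
      ≤ ∑ k ∈ s, 8 * L ^ 2 * Real.exp (-(‖latticeCast k - m‖ / (2 * L))) :=
        Finset.sum_le_sum fun k _ => sq_mul_exp_neg_le (norm_nonneg _) (by linarith)
    _ ≤ 8 * L ^ 2 * (12 * (Fintype.card ι * (2 * L))) ^ Fintype.card ι := by
        rw [← Finset.mul_sum]
        gcongr
        exact sum_exp_neg_norm_sub_le s m (by linarith)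

lemma le_card_Icc_ceil_floor (a : ℝ) {r : ℝ} :
    2 * r - 1 ≤ (Finset.Icc ⌈a - r⌉ ⌊a + r⌋).card := by
  have htoNat : ((⌊a + r⌋ + 1 - ⌈a - r⌉ : ℤ) : ℝ) ≤ ((⌊a + r⌋ + 1 - ⌈a - r⌉).toNat : ℝ) := by
    exact_mod_cast Int.self_le_toNat _
  push_cast at htoNat
  rw [Int.card_Icc]
  linarith [Int.ceil_lt_add_one (a - r), Int.lt_floor_add_one (a + r)]

lemma exists_finset_norm_sub_le (m : ι → ℝ) {r : ℝ} (hr : 1 ≤ r) :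
    ∃ s : Finset (ι → ℤ), (∀ k ∈ s, ‖latticeCast k - m‖ ≤ r) ∧
      r ^ Fintype.card ι ≤ s.card := by
  classical
  refine ⟨Fintype.piFinset fun i => Finset.Icc ⌈m i - r⌉ ⌊m i + r⌋, fun k hk => ?_, ?_⟩
  · rw [pi_norm_le_iff_of_nonneg (by linarith)]
    intro i
    have hki := Finset.mem_Icc.1 (Fintype.mem_piFinset.1 hk i)
    rw [Int.ceil_le, Int.le_floor] at hki
    rw [Real.norm_eq_abs, abs_le, Pi.sub_apply, latticeCast]
    constructor <;> linarith
  · rw [Fintype.card_piFinset, Nat.cast_prod, ← Finset.card_univ, ← Finset.prod_const]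
    exact Finset.prod_le_prod (fun i _ => by linarith) fun i _ =>
      le_trans (by linarith) (le_card_Icc_ceil_floor (m i))

end LatticeSums

section Covariance

open ProbabilityTheory

variable {Ω ι : Type*} [MeasurableSpace Ω] {μ : Measure Ω} [IsProbabilityMeasure μ]

lemma abs_covariance_le {X Y : Ω → ℝ} (hX : MemLp X 2 μ) (hY : MemLp Y 2 μ) :
    |cov[X, Y; μ]| ≤ (Var[X; μ] + Var[Y; μ]) / 2 := by
  have hadd := variance_add hX hY
  have hsub := variance_sub hX hY
  rw [abs_le]
  constructor <;> linarith [variance_nonneg (X + Y) μ, variance_nonneg (X - Y) μ]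

lemma variance_le_integral_sub_sq {X : Ω → ℝ} (hX : AEStronglyMeasurable X μ) (c : ℝ) :
    Var[X; μ] ≤ ∫ ω, (X ω - c) ^ 2 ∂μ := by
  rw [← variance_sub_const hX c]
  exact variance_le_expectation_sq (hX.sub aestronglyMeasurable_const)

lemma dotProduct_mulVec_covariance [Fintype ι] {X : ι → Ω → ℝ} (hX : ∀ i, MemLp (X i) 2 μ)
    (v : ι → ℝ) :
    v ⬝ᵥ (Matrix.of fun i j => cov[X i, X j; μ]).mulVec v =
      Var[fun ω => ∑ i, v i * X i ω; μ] := by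
  rw [variance_fun_sum fun i => (hX i).const_mul (v i)]
  simp only [dotProduct, Matrix.mulVec, Matrix.of_apply, Finset.mul_sum,
    covariance_const_mul_left, covariance_const_mul_right]
  exact Finset.sum_congr rfl fun i _ => Finset.sum_congr rfl fun j _ => by ring

lemma posDef_of_covariance [Fintype ι] {X : ι → Ω → ℝ} (hX : ∀ i, MemLp (X i) 2 μ)
    (hvar : ∀ v : ι → ℝ, v ≠ 0 → Var[fun ω => ∑ i, v i * X i ω; μ] ≠ 0) :
    (Matrix.of fun i j => cov[X i, X j; μ]).PosDef := by
  refine .of_dotProduct_mulVec_pos (Matrix.ext fun i j => covariance_comm _ _) fun v hv => ?_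
  rw [star_trivial, dotProduct_mulVec_covariance hX]
  exact (variance_nonneg _ μ).lt_of_ne' (hvar v hv)

end Covariance

section DiscreteCovariance

open ProbabilityTheory

lemma hasSum_toReal {α : Type*} (p : PMF α) : HasSum (fun a => (p a).toReal) 1 := by
  have hsum := ENNReal.hasSum_toReal p.tsum_coe_ne_top
  rwa [← ENNReal.tsum_toReal_eq p.apply_ne_top, p.tsum_coe, ENNReal.toReal_one] at hsum

section

variable {α : Type*} [Countable α] [MeasurableSpace α] [MeasurableSingletonClass α] {p : PMF α}

lemma integrable_toMeasure_of_summable {h : α → ℝ}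
    (hsum : Summable fun a => (p a).toReal * |h a|) : Integrable h p.toMeasure := by
  refine ⟨(measurable_of_countable h).aestronglyMeasurable, ?_⟩
  have hterm : ∀ a, ‖h a‖ₑ * p.toMeasure {a} = ENNReal.ofReal ((p a).toReal * |h a|) := fun a => by
    rw [p.toMeasure_apply_singleton a (measurableSet_singleton a), mul_comm,
      ENNReal.ofReal_mul ENNReal.toReal_nonneg, ENNReal.ofReal_toReal (p.apply_ne_top a),
      ← Real.norm_eq_abs, ofReal_norm]
  rw [HasFiniteIntegral, lintegral_countable', tsum_congr hterm]
  exact hsum.tsum_ofReal_lt_top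

lemma integral_toMeasure_le {h : α → ℝ} (h0 : ∀ a, 0 ≤ h a) {H : ℝ}
    (hH : ∀ s : Finset α, ∑ a ∈ s, (p a).toReal * h a ≤ H) :
    Integrable h p.toMeasure ∧ ∫ a, h a ∂p.toMeasure ≤ H := by
  have hnonneg : ∀ a, 0 ≤ (p a).toReal * h a := fun a => mul_nonneg ENNReal.toReal_nonneg (h0 a)
  have hint : Integrable h p.toMeasure := by
    refine integrable_toMeasure_of_summable ?_
    simp only [abs_of_nonneg (h0 _)]
    exact summable_of_sum_le hnonneg hH
  refine ⟨hint, ?_⟩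
  rw [p.integral_eq_tsum h hint]
  exact Real.tsum_le_of_sum_le hnonneg hH

end

variable {d : ℕ} {p : PMF (Fin d → ℤ)}

lemma covZ_eq_covariance
    (hp : ∀ i, MemLp (fun k : Fin d → ℤ => latticeCast k i) 2 p.toMeasure) :
    covZ p = Matrix.of fun i j =>
      cov[fun k => latticeCast k i, fun k => latticeCast k j; p.toMeasure] := by
  ext i j
  have hi := (hp i).integrable one_le_two
  have hj := (hp j).integrable one_le_two
  rw [Matrix.of_apply, covariance_eq_sub (hp i) (hp j), p.integral_eq_tsum _ hi,
    p.integral_eq_tsum _ hj, p.integral_eq_tsum _ ((hp i).integrable_mul (hp j))]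
  simp only [covZ, Matrix.of_apply, latticeCast, Pi.mul_apply, smul_eq_mul, mul_comm (p _).toReal]

lemma variance_latticeCast_le {m : Fin d → ℝ} {H : ℝ}
    (hH : ∀ s : Finset (Fin d → ℤ), ∑ k ∈ s, (p k).toReal * ‖latticeCast k - m‖ ^ 2 ≤ H)
    (i : Fin d) :
    MemLp (fun k : Fin d → ℤ => latticeCast k i) 2 p.toMeasure ∧
      Var[fun k => latticeCast k i; p.toMeasure] ≤ H := by
  have hmeas : AEStronglyMeasurable (fun k : Fin d → ℤ => latticeCast k i) p.toMeasure :=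
    (measurable_of_countable _).aestronglyMeasurable
  obtain ⟨hint, hle⟩ := integral_toMeasure_le (p := p) (H := H)
    (fun k => sq_nonneg (latticeCast k i - m i)) fun s => (Finset.sum_le_sum fun k _ => by
      rw [← sq_abs]
      gcongr
      exact norm_le_pi_norm (latticeCast k - m) i).trans (hH s)
  refine ⟨?_, (variance_le_integral_sub_sq hmeas (m i)).trans hle⟩
  have hsub := (memLp_two_iff_integrable_sq (hmeas.sub (aestronglyMeasurable_const (b := m i)))).2
    hint
  simpa using hsub.add (memLp_const (m i))

lemma det_covZ_le {m : Fin d → ℝ} {H : ℝ}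
    (hH : ∀ s : Finset (Fin d → ℤ), ∑ k ∈ s, (p k).toReal * ‖latticeCast k - m‖ ^ 2 ≤ H) :
    (covZ p).det ≤ d.factorial * H ^ d := by
  have hvar := variance_latticeCast_le hH
  have hentry : ∀ i j, |covZ p i j| ≤ H := fun i j => by
    rw [covZ_eq_covariance fun i => (hvar i).1]
    exact (abs_covariance_le (hvar i).1 (hvar j).1).trans (by linarith [(hvar i).2, (hvar j).2])
  have hdet := Matrix.det_le (A := covZ p) (abv := AbsoluteValue.abs) hentry
  rw [Fintype.card_fin, nsmul_eq_mul] at hdet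
  exact (le_abs_self _).trans hdet

lemma posDef_covZ (hp : ∀ i, MemLp (fun k : Fin d → ℤ => latticeCast k i) 2 p.toMeasure)
    {k₀ : Fin d → ℤ} (h0 : p k₀ ≠ 0) (h1 : ∀ i, p (k₀ + Pi.single i 1) ≠ 0) :
    (covZ p).PosDef := by
  rw [covZ_eq_covariance hp]
  refine posDef_of_covariance hp fun v hv hvar => hv (funext fun i => ?_)
  have hmem : MemLp (fun k : Fin d → ℤ => ∑ i, v i * latticeCast k i) 2 p.toMeasure :=
    memLp_finsetSum _ fun i _ => (hp i).const_mul (v i)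
  have hconst := ae_eq_integral_of_variance_eq_zero hmem hvar
  have hatom : ∀ k, p k ≠ 0 → ∑ i, v i * latticeCast k i =
      ∫ k, ∑ i, v i * latticeCast k i ∂p.toMeasure := fun k hk => by
    refine ae_iff_of_countable.1 hconst k ?_
    rwa [p.toMeasure_apply_singleton k (measurableSet_singleton k)]
  have hstep : ∑ j, v j * latticeCast (k₀ + Pi.single i 1) j =
      ∑ j, v j * latticeCast k₀ j + v i := by
    simp [latticeCast, mul_add, Finset.sum_add_distrib, Pi.single_apply]
  simpa [hatom _ (h1 i), hatom _ h0] using hstep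

lemma mul_pow_le_one_of_plateau {m : Fin d → ℝ} {r T : ℝ} (hr : 1 ≤ r) (hT : 0 ≤ T)
    (hlow : ∀ k, ‖latticeCast k - m‖ ≤ r → T ≤ (p k).toReal) : T * r ^ d ≤ 1 := by
  obtain ⟨s, hs, hcard⟩ := exists_finset_norm_sub_le m hr
  rw [Fintype.card_fin] at hcard
  calc T * r ^ d ≤ T * s.card := by gcongr
    _ = ∑ _k ∈ s, T := by rw [Finset.sum_const, nsmul_eq_mul, mul_comm]
    _ ≤ ∑ k ∈ s, (p k).toReal := Finset.sum_le_sum fun k hk => hlow k (hs k hk)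
    _ ≤ 1 := sum_le_hasSum s (fun k _ => ENNReal.toReal_nonneg) (hasSum_toReal p)

lemma sum_toReal_mul_norm_sub_sq_le [NeZero d] {m : Fin d → ℝ} {S L : ℝ} (hS : 0 ≤ S) (hL : 1 ≤ L)
    (hup : ∀ k, (p k).toReal ≤ S * Real.exp (-(‖latticeCast k - m‖ / L)))
    (s : Finset (Fin d → ℤ)) :
    ∑ k ∈ s, (p k).toReal * ‖latticeCast k - m‖ ^ 2 ≤ 8 * (24 * d) ^ d * (S * L ^ d) * L ^ 2 := by
  calc ∑ k ∈ s, (p k).toReal * ‖latticeCast k - m‖ ^ 2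
      ≤ ∑ k ∈ s, S * Real.exp (-(‖latticeCast k - m‖ / L)) * ‖latticeCast k - m‖ ^ 2 := by
        gcongr with k
        exact hup k
    _ = S * ∑ k ∈ s, ‖latticeCast k - m‖ ^ 2 * Real.exp (-(‖latticeCast k - m‖ / L)) := by
        rw [Finset.mul_sum]
        exact Finset.sum_congr rfl fun k _ => by ring
    _ ≤ S * (8 * L ^ 2 * (12 * (d * (2 * L))) ^ d) := by
        gcongr
        simpa only [Fintype.card_fin] using sum_norm_sub_sq_mul_exp_le s m hL
    _ = 8 * (24 * d) ^ d * (S * L ^ d) * L ^ 2 := by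
        rw [show 12 * (d * (2 * L)) = 24 * d * L by ring, mul_pow _ L]
        ring

lemma toReal_mul_sqrt_det_covZ_le [NeZero d] {m : Fin d → ℝ} {S L Q : ℝ} (hS : 0 ≤ S) (hL : 1 ≤ L)
    (hQ : S * L ^ d ≤ Q) (hup : ∀ k, (p k).toReal ≤ S * Real.exp (-(‖latticeCast k - m‖ / L)))
    (k : Fin d → ℤ) :
    (p k).toReal * √(covZ p).det ≤ Q * √(d.factorial * (8 * (24 * d) ^ d * Q) ^ d) := by
  have : 0 < L := zero_lt_one.trans_le hL
  have hQ0 : 0 ≤ Q := le_trans (by positivity) hQ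
  have hpk : (p k).toReal ≤ S := (hup k).trans <| mul_le_of_le_one_right hS <|
    Real.exp_le_one_iff.2 (neg_nonpos.2 (by positivity))
  have hdet : (covZ p).det ≤ d.factorial * (8 * (24 * d) ^ d * Q * L ^ 2) ^ d :=
    det_covZ_le fun s => (sum_toReal_mul_norm_sub_sq_le hS hL hup s).trans (by gcongr)
  calc (p k).toReal * √(covZ p).det
      ≤ S * √(d.factorial * (8 * (24 * d) ^ d * Q * L ^ 2) ^ d) := by gcongr
    _ = S * L ^ d * √(d.factorial * (8 * (24 * d) ^ d * Q) ^ d) := by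
        rw [mul_pow _ (L ^ 2), ← mul_assoc, ← pow_mul, mul_comm 2 d, pow_mul,
          Real.sqrt_mul (by positivity), Real.sqrt_sq (by positivity)]
        ring
    _ ≤ Q * √(d.factorial * (8 * (24 * d) ^ d * Q) ^ d) := by gcongr

lemma norm_latticeCast_round_sub_le {ι : Type*} [Fintype ι] (m : ι → ℝ) :
    ‖latticeCast (fun i => round (m i)) - m‖ ≤ 1 / 2 := by
  rw [pi_norm_le_iff_of_nonneg (by norm_num)]
  intro i
  rw [Pi.sub_apply, norm_sub_rev]
  exact abs_sub_round (m i)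

lemma latticeCast_add {ι : Type*} (k l : ι → ℤ) :
    latticeCast (k + l) = latticeCast k + latticeCast l :=
  funext fun i => Int.cast_add (k i) (l i)

lemma norm_latticeCast_single_one {ι : Type*} [Fintype ι] [DecidableEq ι] (i : ι) :
    ‖latticeCast (Pi.single i 1)‖ = 1 := by
  have : latticeCast (Pi.single i 1) = Pi.single i (1 : ℝ) := by
    ext j
    rw [latticeCast, Pi.single_apply, Pi.single_apply]
    split_ifs <;> simp
  rw [this, Pi.norm_single, norm_one]

lemma det_covZ_pos_of_plateau {m : Fin d → ℝ}
    (hp : ∀ i, MemLp (fun k : Fin d → ℤ => latticeCast k i) 2 p.toMeasure)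
    (hpos : ∀ k, ‖latticeCast k - m‖ < 2 → p k ≠ 0) : 0 < (covZ p).det := by
  have hround := norm_latticeCast_round_sub_le m
  refine (posDef_covZ hp (hpos _ (hround.trans_lt (by norm_num))) fun i => hpos _ ?_).det_pos
  rw [latticeCast_add, add_sub_right_comm]
  refine (norm_add_le _ _).trans_lt ?_
  linarith [norm_latticeCast_single_one i]

lemma toReal_le_div_sqrt_det_covZ [NeZero d] {m : Fin d → ℝ} {t S r L : ℝ} (ht : 0 < t)
    (hS : 0 < S) (hr : 2 ≤ r) (hL : 1 ≤ L)
    (hlow : ∀ k, ‖latticeCast k - m‖ < r → t * S ≤ (p k).toReal)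
    (hup : ∀ k, (p k).toReal ≤ S * Real.exp (-(‖latticeCast k - m‖ / L))) {Q : ℝ}
    (hQ : (2 * L / r) ^ d / t ≤ Q) (k : Fin d → ℤ) :
    (p k).toReal ≤ Q * √(d.factorial * (8 * (24 * d) ^ d * Q) ^ d) / √(covZ p).det := by
  have hpos : ∀ k, ‖latticeCast k - m‖ < 2 → p k ≠ 0 := fun k hk hk0 => by
    have := hlow k (hk.trans_le hr)
    rw [hk0, ENNReal.toReal_zero] at this
    exact this.not_gt (mul_pos ht hS)
  have hdet : 0 < (covZ p).det := det_covZ_pos_of_plateau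
    (fun i => (variance_latticeCast_le (sum_toReal_mul_norm_sub_sq_le hS.le hL hup) i).1) hpos
  have hplateau : t * S * (r / 2) ^ d ≤ 1 :=
    mul_pow_le_one_of_plateau (m := m) (by linarith) (by positivity)
      fun k hk => hlow k (by linarith)
  have hSQ : S * L ^ d ≤ Q := by
    refine le_trans ?_ hQ
    rw [le_div_iff₀ ht]
    calc S * L ^ d * t = t * S * (r / 2) ^ d * (2 * L / r) ^ d := by
          rw [mul_assoc (t * S), ← mul_pow, show r / 2 * (2 * L / r) = L by field_simp]
          ring
      _ ≤ (2 * L / r) ^ d := mul_le_of_le_one_left (by positivity) hplateau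
  rw [le_div_iff₀ (Real.sqrt_pos.2 hdet)]
  exact toReal_mul_sqrt_det_covZ_le hS.le hL hSQ hup k

end DiscreteCovariance

section NormalizedMeasure

/-- The measure whose density with respect to `μ` is the normalisation `f / ∫ f` of `f`. Used for
`f ≥ 0` with `0 < ∫ f`, when it is a probability measure. -/
noncomputable def normalizedMeasure {α : Type*} [MeasurableSpace α] (μ : Measure α) (f : α → ℝ) :
    Measure α :=
  μ.withDensity fun x => ENNReal.ofReal (f x / ∫ y, f y ∂μ)

variable {α : Type*} [MeasurableSpace α] {μ : Measure α} {f : α → ℝ}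

lemma integrable_of_integral_pos (hI : 0 < ∫ x, f x ∂μ) : Integrable f μ :=
  not_imp_comm.1 integral_undef hI.ne'

lemma aemeasurable_ofReal_div_integral (hI : 0 < ∫ x, f x ∂μ) :
    AEMeasurable (fun x => ENNReal.ofReal (f x / ∫ y, f y ∂μ)) μ :=
  ((integrable_of_integral_pos hI).aemeasurable.div_const _).ennreal_ofReal

lemma isProbabilityMeasure_normalizedMeasure (hf : ∀ x, 0 ≤ f x) (hI : 0 < ∫ x, f x ∂μ) :
    IsProbabilityMeasure (normalizedMeasure μ f) := by
  refine ⟨?_⟩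
  rw [normalizedMeasure, withDensity_apply _ .univ, Measure.restrict_univ,
    ← ofReal_integral_eq_lintegral_ofReal ((integrable_of_integral_pos hI).div_const _)
    (ae_of_all _ fun x => div_nonneg (hf x) hI.le), integral_div, div_self hI.ne',
    ENNReal.ofReal_one]

lemma integral_normalizedMeasure (hf : ∀ x, 0 ≤ f x) (hI : 0 < ∫ x, f x ∂μ) (h : α → ℝ) :
    ∫ x, h x ∂normalizedMeasure μ f = (∫ x, h x * f x ∂μ) / ∫ x, f x ∂μ := by
  rw [normalizedMeasure, integral_withDensity_eq_integral_toReal_smul₀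
    (aemeasurable_ofReal_div_integral hI) (ae_of_all _ fun x => ENNReal.ofReal_lt_top),
    ← integral_div]
  refine integral_congr_ae (ae_of_all _ fun x => ?_)
  simp only [ENNReal.toReal_ofReal (div_nonneg (hf x) hI.le), smul_eq_mul]
  ring

lemma integrable_normalizedMeasure_iff (hf : ∀ x, 0 ≤ f x) (hI : 0 < ∫ x, f x ∂μ) {h : α → ℝ} :
    Integrable h (normalizedMeasure μ f) ↔ Integrable (fun x => h x * f x) μ := by
  rw [normalizedMeasure, integrable_withDensity_iff_integrable_smul₀'
    (aemeasurable_ofReal_div_integral hI) (ae_of_all _ fun x => ENNReal.ofReal_lt_top)]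
  refine Iff.trans ?_ (integrable_mul_const_iff (inv_pos.2 hI).ne'.isUnit _)
  refine integrable_congr (ae_of_all _ fun x => ?_)
  simp only [ENNReal.toReal_ofReal (div_nonneg (hf x) hI.le), smul_eq_mul]
  ring

end NormalizedMeasure

section ContinuousCovariance

open ProbabilityTheory

variable {d : ℕ} {f : (Fin d → ℝ) → ℝ}

lemma integral_pos_of_covR_pos (hf : ∀ x, 0 ≤ f x) {i : Fin d} (hi : 0 < covR f i i) :
    0 < ∫ x, f x :=
  (integral_nonneg hf).lt_of_ne' fun h => by simp [covR, h] at hi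

lemma integrable_sq_mul_of_covR_pos {i : Fin d} (hi : 0 < covR f i i) :
    Integrable fun x : Fin d → ℝ => x i ^ 2 * f x := by
  by_contra hnot
  have hzero : ∫ x : Fin d → ℝ, x i * x i * f x = 0 := by
    simpa only [sq] using integral_undef hnot
  refine hi.not_ge ?_
  simp only [covR, Matrix.of_apply, hzero, zero_div, zero_sub, neg_nonpos]
  exact div_nonneg (mul_self_nonneg _) (sq_nonneg _)

lemma memLp_id_normalizedMeasure (hf : ∀ x, 0 ≤ f x) (hpos : ∀ i, 0 < covR f i i) :
    MemLp id 2 (normalizedMeasure volume f) := by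
  refine MemLp.of_eval fun i => (memLp_two_iff_integrable_sq ?_).2 ?_
  · exact (measurable_pi_apply i).aestronglyMeasurable
  · exact (integrable_normalizedMeasure_iff hf (integral_pos_of_covR_pos hf (hpos i))).2
      (integrable_sq_mul_of_covR_pos (hpos i))

lemma covR_eq_covariance (hf : ∀ x, 0 ≤ f x) (hpos : ∀ i, 0 < covR f i i) :
    covR f = Matrix.of fun i j =>
      cov[fun x => x i, fun x => x j; normalizedMeasure volume f] := by
  ext i j
  have hI := integral_pos_of_covR_pos hf (hpos i)
  have := isProbabilityMeasure_normalizedMeasure hf hI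
  have hmem := (memLp_id_normalizedMeasure hf hpos).eval
  rw [Matrix.of_apply]
  refine Eq.trans ?_ (covariance_eq_sub (hmem i) (hmem j)).symm
  simp only [integral_normalizedMeasure hf hI, covR, Matrix.of_apply, Pi.mul_apply, id_eq]
  ring

lemma dual_apply_eq_sum (φ : StrongDual ℝ (Fin d → ℝ)) (x : Fin d → ℝ) :
    φ x = ∑ i, φ (Pi.single i 1) * x i := by
  conv_lhs => rw [pi_eq_sum_univ' x]
  simp [mul_comm]

lemma sq_norm_dual_le (φ : StrongDual ℝ (Fin d → ℝ)) :
    ‖φ‖ ^ 2 ≤ d * ∑ i, φ (Pi.single i 1) ^ 2 := by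
  have hle : ‖φ‖ ≤ ∑ i, |φ (Pi.single i 1)| := by
    refine φ.opNorm_le_bound (Finset.sum_nonneg fun i _ => abs_nonneg _) fun x => ?_
    rw [dual_apply_eq_sum φ x, Finset.sum_mul]
    refine (norm_sum_le _ _).trans (Finset.sum_le_sum fun i _ => ?_)
    rw [norm_mul, Real.norm_eq_abs]
    gcongr
    exact norm_le_pi_norm x i
  calc ‖φ‖ ^ 2 ≤ (∑ i, |φ (Pi.single i 1)|) ^ 2 := by gcongr
    _ ≤ d * ∑ i, φ (Pi.single i 1) ^ 2 := by
        simpa using sq_sum_le_card_mul_sum_sq (s := Finset.univ) (f := fun i => |φ (Pi.single i 1)|)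

lemma variance_dual_normalizedMeasure [NeZero d] (hf : ∀ x, 0 ≤ f x) (hpos : ∀ i, 0 < covR f i i)
    (φ : StrongDual ℝ (Fin d → ℝ)) :
    Var[φ; normalizedMeasure volume f] =
      (fun i => φ (Pi.single i 1)) ⬝ᵥ (covR f).mulVec fun i => φ (Pi.single i 1) := by
  have := isProbabilityMeasure_normalizedMeasure hf (integral_pos_of_covR_pos hf (hpos 0))
  have hmem := (memLp_id_normalizedMeasure hf hpos).eval
  rw [covR_eq_covariance hf hpos]
  refine Eq.trans ?_ (dotProduct_mulVec_covariance hmem _).symm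
  exact congrArg (Var[·; normalizedMeasure volume f]) (funext (dual_apply_eq_sum φ))

end ContinuousCovariance

section Rescaling

open ProbabilityTheory

variable {E : Type*} [NormedAddCommGroup E] [NormedSpace ℝ E] [MeasurableSpace E]

/-- The density of `(X - m) / σ` for a random vector `X` whose density is proportional to `f`. -/
noncomputable def rescaledDensity (μ : Measure E) (f : E → ℝ) (m : E) (σ : ℝ) (x : E) : ℝ :=
  σ ^ Module.finrank ℝ E / (∫ y, f y ∂μ) * f (m + σ • x)

variable {μ : Measure E} {f : E → ℝ} {σ : ℝ}

lemma eq_mul_rescaledDensity (hI : 0 < ∫ x, f x ∂μ) (hσ : 0 < σ) (m y : E) :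
    f y = (∫ x, f x ∂μ) / σ ^ Module.finrank ℝ E * rescaledDensity μ f m σ (σ⁻¹ • (y - m)) := by
  rw [rescaledDensity, smul_inv_smul₀ hσ.ne', add_sub_cancel]
  field_simp

lemma MulLogConcave.rescaledDensity (hf : MulLogConcave f) (hI : 0 < ∫ x, f x ∂μ) (hσ : 0 < σ)
    (m : E) : MulLogConcave (rescaledDensity μ f m σ) := by
  have haffine := hf.comp_affineMap (AffineMap.const ℝ E m + (σ • LinearMap.id).toAffineMap)
  exact haffine.const_mul (by positivity)

variable [FiniteDimensional ℝ E] [BorelSpace E] [μ.IsAddHaarMeasure]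

lemma integral_mul_rescaledDensity (hf : ∀ x, 0 ≤ f x) (hI : 0 < ∫ x, f x ∂μ) (hσ : 0 < σ)
    (m : E) (h : E → ℝ) :
    ∫ x, h x * rescaledDensity μ f m σ x ∂μ =
      ∫ y, h (σ⁻¹ • (y - m)) ∂normalizedMeasure μ f := by
  have hcomp := integral_comp_add_smul μ (fun y => h (σ⁻¹ • (y - m)) * f y) m hσ.le
  simp only [add_sub_cancel_left, inv_smul_smul₀ hσ.ne'] at hcomp
  calc ∫ x, h x * rescaledDensity μ f m σ x ∂μ
      = σ ^ Module.finrank ℝ E / (∫ y, f y ∂μ) * ∫ x, h x * f (m + σ • x) ∂μ := by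
        rw [← integral_const_mul]
        exact integral_congr_ae (ae_of_all _ fun x => by simp only [rescaledDensity]; ring)
    _ = (∫ y, h (σ⁻¹ • (y - m)) * f y ∂μ) / ∫ y, f y ∂μ := by
        rw [hcomp]
        field_simp
    _ = ∫ y, h (σ⁻¹ • (y - m)) ∂normalizedMeasure μ f := (integral_normalizedMeasure hf hI _).symm

lemma integrable_mul_rescaledDensity (hf : ∀ x, 0 ≤ f x) (hI : 0 < ∫ x, f x ∂μ) (hσ : 0 < σ)
    {m : E} {h : E → ℝ} (hh : Integrable (fun y => h (σ⁻¹ • (y - m))) (normalizedMeasure μ f)) :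
    Integrable (fun x => h x * rescaledDensity μ f m σ x) μ := by
  have hcomp := integrable_comp_add_smul ((integrable_normalizedMeasure_iff hf hI).1 hh) m hσ.ne'
  simp only [add_sub_cancel_left, inv_smul_smul₀ hσ.ne'] at hcomp
  refine (hcomp.const_mul (σ ^ Module.finrank ℝ E / ∫ y, f y ∂μ)).congr (ae_of_all _ fun x => ?_)
  simp only [rescaledDensity]
  ring

lemma isLogConcaveDensity_rescaledDensity (hf : MulLogConcave f) (hI : 0 < ∫ x, f x ∂μ)
    (hσ : 0 < σ) (hmem : MemLp id 2 (normalizedMeasure μ f)) (m : E) :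
    IsLogConcaveDensity μ (rescaledDensity μ f m σ) := by
  have := isProbabilityMeasure_normalizedMeasure hf.nonneg hI
  refine ⟨hf.rescaledDensity hI hσ m, ?_, ?_, ?_⟩
  · simpa using integrable_mul_rescaledDensity hf.nonneg hI hσ (m := m) (h := fun _ => 1)
      (integrable_const 1)
  · simpa using integral_mul_rescaledDensity hf.nonneg hI hσ m fun _ => 1
  · exact integrable_mul_rescaledDensity hf.nonneg hI hσ
      (((hmem.sub (memLp_const m)).const_smul σ⁻¹).integrable_norm_pow two_ne_zero)

lemma integral_dual_mul_rescaledDensity (hf : ∀ x, 0 ≤ f x) (hI : 0 < ∫ x, f x ∂μ) (hσ : 0 < σ)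
    (hmem : MemLp id 2 (normalizedMeasure μ f)) (φ : StrongDual ℝ E) :
    ∫ x, φ x * rescaledDensity μ f (∫ y, y ∂normalizedMeasure μ f) σ x ∂μ = 0 := by
  have := isProbabilityMeasure_normalizedMeasure hf hI
  have hint : Integrable (fun y : E => y) (normalizedMeasure μ f) := hmem.integrable one_le_two
  rw [integral_mul_rescaledDensity hf hI hσ]
  simp only [map_smul, map_sub, smul_eq_mul]
  rw [integral_const_mul, integral_sub (φ.integrable_comp hint) (integrable_const _),
    φ.integral_comp_comm hint, integral_const, probReal_univ, one_smul, sub_self, mul_zero]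

lemma integral_dual_sq_mul_rescaledDensity (hf : ∀ x, 0 ≤ f x) (hI : 0 < ∫ x, f x ∂μ) (hσ : 0 < σ)
    (hmem : MemLp id 2 (normalizedMeasure μ f)) (φ : StrongDual ℝ E) :
    ∫ x, φ x ^ 2 * rescaledDensity μ f (∫ y, y ∂normalizedMeasure μ f) σ x ∂μ =
      Var[φ; normalizedMeasure μ f] / σ ^ 2 := by
  have := isProbabilityMeasure_normalizedMeasure hf hI
  have hint : Integrable (fun y : E => y) (normalizedMeasure μ f) := hmem.integrable one_le_two
  rw [integral_mul_rescaledDensity hf hI hσ _ fun x => φ x ^ 2,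
    variance_eq_integral φ.continuous.aemeasurable, φ.integral_comp_comm hint, ← integral_div]
  refine integral_congr_ae (ae_of_all _ fun y => ?_)
  simp only [map_smul, map_sub, smul_eq_mul]
  ring

end Rescaling

section Profile

open ProbabilityTheory

variable {d : ℕ}

lemma sq_norm_le_sum_sq {ι : Type*} [Fintype ι] (x : ι → ℝ) : ‖x‖ ^ 2 ≤ ∑ i, x i ^ 2 := by
  have hnonneg : 0 ≤ ∑ i, x i ^ 2 := Finset.sum_nonneg fun i _ => sq_nonneg _
  rw [← Real.le_sqrt (norm_nonneg _) hnonneg, pi_norm_le_iff_of_nonneg (Real.sqrt_nonneg _)]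
  intro i
  refine Real.abs_le_sqrt ?_
  exact Finset.single_le_sum (f := fun j => x j ^ 2) (fun j _ => sq_nonneg _) (Finset.mem_univ i)

lemma integral_norm_sq_mul_le_sum {g : (Fin d → ℝ) → ℝ} (hg : IsLogConcaveDensity volume g) :
    ∫ x, ‖x‖ ^ 2 * g x ≤ ∑ i, ∫ x : Fin d → ℝ, x i ^ 2 * g x := by
  have hint : ∀ i, Integrable fun x : Fin d → ℝ => x i ^ 2 * g x := fun i =>
    hg.integrable_dual_sq_mul (ContinuousLinearMap.proj i)
  rw [← integral_finsetSum _ fun i _ => hint i]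
  refine integral_mono hg.integrable_norm_sq_mul (integrable_finsetSum _ fun i _ => hint i)
    fun x => ?_
  rw [← Finset.sum_mul]
  exact mul_le_mul_of_nonneg_right (sq_norm_le_sum_sq x) (hg.nonneg x)

variable {f : (Fin d → ℝ) → ℝ} {σ a b : ℝ}

lemma covR_apply_self_pos (ha : 0 < a) (hσ : 0 < σ)
    (hlower : ∀ v, a * σ ^ 2 * (v ⬝ᵥ v) ≤ v ⬝ᵥ (covR f).mulVec v) (i : Fin d) :
    0 < covR f i i := by
  have := hlower (Pi.single i 1)
  simp only [single_dotProduct, Pi.single_eq_same, Matrix.mulVec_single_one, mul_one, one_mul,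
    Matrix.col_apply] at this
  exact lt_of_lt_of_le (by positivity) this

variable [NeZero d]

lemma integral_norm_sq_mul_rescaledDensity_le (hf : MulLogConcave f) (hσ : 0 < σ)
    (hpos : ∀ i, 0 < covR f i i) (hupper : ∀ i, covR f i i ≤ b * σ ^ 2) :
    ∫ x, ‖x‖ ^ 2 * rescaledDensity volume f (∫ y, y ∂normalizedMeasure volume f) σ x ≤
      d * b := by
  have hI := integral_pos_of_covR_pos hf.nonneg (hpos 0)
  have hmem := memLp_id_normalizedMeasure hf.nonneg hpos
  refine (integral_norm_sq_mul_le_sum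
    (isLogConcaveDensity_rescaledDensity hf hI hσ hmem _)).trans ?_
  refine (Finset.sum_le_card_nsmul _ _ b fun i _ => ?_).trans_eq
    (by rw [Finset.card_univ, Fintype.card_fin, nsmul_eq_mul])
  have hcoord := integral_dual_sq_mul_rescaledDensity hf.nonneg hI hσ hmem
    (ContinuousLinearMap.proj i)
  rw [variance_dual_normalizedMeasure hf.nonneg hpos] at hcoord
  refine hcoord.trans_le ?_
  rw [div_le_iff₀ (by positivity)]
  simpa [Pi.single_apply, dotProduct, Matrix.mulVec] using hupper i

lemma le_integral_dual_sq_mul_rescaledDensity (hf : MulLogConcave f) (ha : 0 < a) (hσ : 0 < σ)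
    (hlower : ∀ v, a * σ ^ 2 * (v ⬝ᵥ v) ≤ v ⬝ᵥ (covR f).mulVec v)
    {φ : StrongDual ℝ (Fin d → ℝ)} (hφ : ‖φ‖ = 1) :
    a / d ≤
      ∫ x, φ x ^ 2 * rescaledDensity volume f (∫ y, y ∂normalizedMeasure volume f) σ x := by
  have hpos := covR_apply_self_pos ha hσ hlower
  have hd : (0 : ℝ) < d := Nat.cast_pos.2 (NeZero.pos d)
  have hnorm := sq_norm_dual_le φ
  rw [hφ, one_pow, ← div_le_iff₀' hd] at hnorm
  rw [integral_dual_sq_mul_rescaledDensity hf.nonneg (integral_pos_of_covR_pos hf.nonneg (hpos 0))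
    hσ (memLp_id_normalizedMeasure hf.nonneg hpos), variance_dual_normalizedMeasure hf.nonneg hpos,
    le_div_iff₀ (by positivity)]
  refine le_trans ?_ (hlower _)
  calc a / d * σ ^ 2 = a * σ ^ 2 * (1 / d) := by ring
    _ ≤ a * σ ^ 2 * ∑ i, φ (Pi.single i 1) ^ 2 := by gcongr
    _ = _ := by simp only [dotProduct, sq]

lemma exists_profile_of_covR_bounds (d : ℕ) [NeZero d] {a : ℝ} (ha : 0 < a) (b : ℝ) :
    ∃ c t κ : ℝ, 0 < c ∧ 0 < t ∧ 0 < κ ∧ ∀ (f : (Fin d → ℝ) → ℝ) (σ : ℝ), MulLogConcave f →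
      0 < σ → (∀ v, a * σ ^ 2 * (v ⬝ᵥ v) ≤ v ⬝ᵥ (covR f).mulVec v) →
      (∀ i, covR f i i ≤ b * σ ^ 2) →
        ∃ m S, 0 < S ∧ (∀ x, ‖x - m‖ < c * σ → t * S ≤ f x) ∧
          ∀ x, f x ≤ S * Real.exp (-(‖x - m‖ / (σ / κ))) := by
  have hd : (0 : ℝ) < d := Nat.cast_pos.2 (NeZero.pos d)
  obtain ⟨c, t, κ, hc, ht, hκ, hprofile⟩ := IsLogConcaveDensity.exists_profile
    (volume : Measure (Fin d → ℝ)) (d * b) (div_pos ha hd)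
  refine ⟨c, t, κ, hc, ht, hκ, fun f σ hf hσ hlower hupper => ?_⟩
  have hpos := covR_apply_self_pos ha hσ hlower
  have hI := integral_pos_of_covR_pos hf.nonneg (hpos 0)
  have hmem := memLp_id_normalizedMeasure hf.nonneg hpos
  set m := ∫ y, y ∂normalizedMeasure volume f
  obtain ⟨S, hS, hlow, hup⟩ := hprofile _ (isLogConcaveDensity_rescaledDensity hf hI hσ hmem m)
    (integral_norm_sq_mul_rescaledDensity_le hf hσ hpos hupper)
    (integral_dual_mul_rescaledDensity hf.nonneg hI hσ hmem)
    fun φ hφ => le_integral_dual_sq_mul_rescaledDensity hf ha hσ hlower hφ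
  set K := (∫ x, f x) / σ ^ Module.finrank ℝ (Fin d → ℝ)
  have hK : 0 < K := by positivity
  have hnorm : ∀ x, ‖σ⁻¹ • (x - m)‖ = ‖x - m‖ / σ := fun x => by
    rw [norm_smul, norm_inv, Real.norm_of_nonneg hσ.le, inv_mul_eq_div]
  refine ⟨m, K * S, mul_pos hK hS, fun x hx => ?_, fun x => ?_⟩
  · rw [eq_mul_rescaledDensity hI hσ m x, mul_left_comm]
    exact mul_le_mul_of_nonneg_left (hlow _ (by rwa [hnorm, div_lt_iff₀ hσ])) hK.le
  · rw [eq_mul_rescaledDensity hI hσ m x, mul_assoc, div_div_eq_mul_div, mul_comm ‖x - m‖ κ,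
      mul_div_assoc, ← hnorm]
    exact mul_le_mul_of_nonneg_left (hup _) hK.le

end Profile

section AlmostIsotropic

variable {d : ℕ} {f : (Fin d → ℝ) → ℝ} {A : ℝ}

lemma AlmostIsotropic.nonneg [NeZero d] (h : AlmostIsotropic A f) (hσ : 0 < sigmaR f) : 0 ≤ A :=
  nonneg_of_mul_nonneg_left ((abs_nonneg _).trans (h.1 0)) hσ

lemma AlmostIsotropic.abs_covR_sub_le (h : AlmostIsotropic A f) (i j : Fin d) :
    |(covR f - sigmaR f ^ 2 • (1 : Matrix (Fin d) (Fin d) ℝ)) i j| ≤ A * sigmaR f := by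
  rcases eq_or_ne i j with rfl | hij
  · simpa using h.1 i
  · simpa [Matrix.one_apply_ne hij] using h.2 i j hij

lemma abs_dotProduct_mulVec_le {ι : Type*} [Fintype ι] {M : Matrix ι ι ℝ} {B : ℝ} (hB : 0 ≤ B)
    (hM : ∀ i j, |M i j| ≤ B) (v : ι → ℝ) :
    |v ⬝ᵥ M.mulVec v| ≤ Fintype.card ι * B * (v ⬝ᵥ v) := by
  have hcauchy := sq_sum_le_card_mul_sum_sq (s := Finset.univ) (f := fun i => |v i|)
  simp only [sq_abs, Finset.card_univ] at hcauchy
  calc |v ⬝ᵥ M.mulVec v| = |∑ i, ∑ j, v i * (M i j * v j)| := by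
        simp only [dotProduct, Matrix.mulVec, Finset.mul_sum]
    _ ≤ ∑ i, ∑ j, |v i| * (B * |v j|) := by
        refine (Finset.abs_sum_le_sum_abs _ _).trans (Finset.sum_le_sum fun i _ => ?_)
        refine (Finset.abs_sum_le_sum_abs _ _).trans (Finset.sum_le_sum fun j _ => ?_)
        rw [abs_mul, abs_mul]
        gcongr
        exact hM i j
    _ = B * (∑ i, |v i|) ^ 2 := by
        rw [sq, Finset.sum_mul_sum, Finset.mul_sum]
        simp only [Finset.mul_sum, mul_left_comm]
    _ ≤ B * (Fintype.card ι * ∑ i, v i ^ 2) := by gcongr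
    _ = Fintype.card ι * B * (v ⬝ᵥ v) := by
        simp only [dotProduct, sq]
        ring

lemma AlmostIsotropic.half_sq_mul_le_dotProduct_mulVec [NeZero d] (h : AlmostIsotropic A f)
    (hσ : 0 < sigmaR f) (hA : 2 * d * A ≤ sigmaR f) (v : Fin d → ℝ) :
    1 / 2 * sigmaR f ^ 2 * (v ⬝ᵥ v) ≤ v ⬝ᵥ (covR f).mulVec v := by
  have hoff := neg_le_of_abs_le
    (abs_dotProduct_mulVec_le (mul_nonneg (h.nonneg hσ) hσ.le) h.abs_covR_sub_le v)
  rw [Matrix.sub_mulVec, Matrix.smul_mulVec, Matrix.one_mulVec, dotProduct_sub, dotProduct_smul,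
    smul_eq_mul, Fintype.card_fin] at hoff
  have hv : 0 ≤ v ⬝ᵥ v := Finset.sum_nonneg fun i _ => mul_self_nonneg _
  have herror : d * (A * sigmaR f) * (v ⬝ᵥ v) ≤ 1 / 2 * sigmaR f ^ 2 * (v ⬝ᵥ v) := by
    refine mul_le_mul_of_nonneg_right ?_ hv
    linarith [mul_le_mul_of_nonneg_right hA hσ.le]
  linarith

lemma AlmostIsotropic.covR_apply_self_le [NeZero d] (h : AlmostIsotropic A f)
    (hσ : 0 < sigmaR f) (hA : 2 * d * A ≤ sigmaR f) (i : Fin d) :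
    covR f i i ≤ 3 / 2 * sigmaR f ^ 2 := by
  have hd : (1 : ℝ) ≤ d := Nat.one_le_cast.2 NeZero.one_le
  have hdA : A ≤ d * A := le_mul_of_one_le_left (h.nonneg hσ) hd
  have herror : 2 * A * sigmaR f ≤ sigmaR f * sigmaR f :=
    mul_le_mul_of_nonneg_right (by linarith) hσ.le
  linarith [le_of_abs_le (h.1 i)]

lemma le_sigmaR_of_pow_le_det (hd : 1 ≤ d) {s : ℝ} (hs : 0 ≤ s)
    (h : s ^ (2 * d) ≤ (covR f).det) : s ≤ sigmaR f := by
  calc s = (s ^ (2 * d)) ^ (((2 * d : ℕ) : ℝ)⁻¹) :=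
        (Real.pow_rpow_inv_natCast hs (by omega)).symm
    _ ≤ (covR f).det ^ (((2 * d : ℕ) : ℝ)⁻¹) := by gcongr
    _ = sigmaR f := by rw [sigmaR, one_div, Nat.cast_mul, Nat.cast_ofNat]

end AlmostIsotropic

theorem mainTheorem3_general (d : ℕ) (hd : 1 ≤ d) {a : ℝ} (ha : 0 < a) (b : ℝ) :
    ∃ C σ₀ : ℝ, 0 < C ∧
      ∀ (p : PMF (Fin d → ℤ)) (f : (Fin d → ℝ) → ℝ) (σ : ℝ),
        IsLogConcaveExtension p f → σ₀ ≤ σ →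
          (∀ v, a * σ ^ 2 * (v ⬝ᵥ v) ≤ v ⬝ᵥ (covR f).mulVec v) →
            (∀ i, covR f i i ≤ b * σ ^ 2) →
              ∀ k : Fin d → ℤ, (p k).toReal ≤ C / √(covZ p).det := by
  have : NeZero d := ⟨by omega⟩
  obtain ⟨c, t, κ, hc, ht, hκ, hprofile⟩ := exists_profile_of_covR_bounds d ha b
  set Q := (2 / (κ * c)) ^ d / t
  refine ⟨Q * √(d.factorial * (8 * (24 * d) ^ d * Q) ^ d), max (2 / c) κ, ?_,
    fun p f σ hpf hσ hlower hupper => ?_⟩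
  · have : (0 : ℝ) < d := Nat.cast_pos.2 hd
    positivity
  have hσpos : 0 < σ := hκ.trans_le ((le_max_right _ _).trans hσ)
  obtain ⟨m, S, hS, hlow, hup⟩ := hprofile f σ hpf.1.mulLogConcave hσpos hlower hupper
  have hr : 2 ≤ c * σ := (div_le_iff₀' hc).1 ((le_max_left _ _).trans hσ)
  have hL : 1 ≤ σ / κ := (one_le_div hκ).2 ((le_max_right _ _).trans hσ)
  refine toReal_le_div_sqrt_det_covZ (m := m) ht hS hr hL (fun k hk => ?_) (fun k => ?_) ?_
  · exact (hlow _ hk).trans_eq (hpf.2 k)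
  · exact (hpf.2 k).symm.trans_le (hup _)
  · exact le_of_eq (by simp only [Q]; field_simp)

theorem mainTheorem3 (d : ℕ) (hd : 1 ≤ d) :
    ∃ C : ℝ, 0 < C ∧
      ∀ A : ℝ, ∃ N : ℝ,
        ∀ (p : PMF (Fin d → ℤ)) (f : (Fin d → ℝ) → ℝ),
          IsLogConcaveExtension p f → AlmostIsotropic A f → N ≤ (covR f).det →
            ∀ k : Fin d → ℤ, (p k).toReal ≤ C / Real.sqrt (covZ p).det := by
  have : NeZero d := ⟨by omega⟩
  obtain ⟨C, σ₀, hC, hbound⟩ := mainTheorem3_general d hd one_half_pos (3 / 2)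
  refine ⟨C, hC, fun A => ⟨max 1 (max σ₀ (2 * d * A)) ^ (2 * d), fun p f hpf hiso hN => ?_⟩⟩
  obtain ⟨hone, hσ₀, hA⟩ := by
    simpa only [max_le_iff] using
      le_sigmaR_of_pow_le_det hd (zero_le_one.trans (le_max_left _ _)) hN
  have hσ : 0 < sigmaR f := zero_lt_one.trans_le hone
  exact hbound p f (sigmaR f) hpf hσ₀ (hiso.half_sq_mul_le_dotProduct_mulVec hσ hA)
    (hiso.covR_apply_self_le hσ hA)
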